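/- Let $\alpha<0$ and $\beta>0$ satisfy $-2\frac{\beta}{\alpha}+\frac1\alpha-1<0$, and let $\gamma\in(0,1)$. Write $(r,\theta,x^{(3)})$ for cylindrical coordinates in $\mathbb R^3$, $e_r,e_\theta,e_3$ for the cylindrical frame, $p_0$ for the point $(r,\theta,x^{(3)})=(1,0,0)$ and $\mathbb R^2_-=\{y=(y_1,y_2): y_1\le 0\}$. Then there do not exist $T_0>0$, a cylinder $D=\{r\le 1,\ a\le x^{(3)}\le b\}$ with $a<0<b$, and an axially symmetric solution $v$ of the incompressible Euler equations $$\partial_t v+v\cdot\nabla v+\nabla p=0,\qquad \nabla\cdot v=0$$ in $D\times[0,T_0)$, with $(v,p)$ smooth up to the boundary and up to the initial time, with $v\cdot e_r=0$ on the side boundary $r=1$ and with equal values of $v$ on the top $x^{(3)}=b$ and the bottom $x^{(3)}=a$, which is asymptotically self-similar and centred at $p_0$ in the following sense: for all $t\in[0,T_0)$ and all $x\in D$ off the axis, $$v(x,t)=\frac{\Theta(y)}{(T_0-t)^{\alpha+\beta}}\,e_\theta+\frac{V^r(y)}{(T_0-t)^{\alpha}}\,e_r+\frac{V^{(3)}(y)}{(T_0-t)^{\alpha}}\,e_3+\frac{\varepsilon(t)}{(T_0-t)^{\alpha}}\,W(x,t),\qquad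 y=\Big(\frac{r-1}{(T_0-t)^{1-\alpha}},\frac{x^{(3)}}{(T_0-t)^{1-\alpha}}\Big),$$ where 1. $\varepsilon(t)\to0$ as $t\to T_0^-$, and the error field $W$ is bounded on $(D\cap B(p_0,\delta))\times([0,T_0)\cap(T_0-\delta,T_0))$ for some $\delta>0$ (no regularity of $W$ is required); 2. $\Theta,V^r,V^{(3)}:\mathbb R^2_-\to\mathbb R$ are local $C^{2,\gamma}$ functions, that is, $C^2$ up to the boundary with second derivatives $\gamma$-Hölder on compact sets; 3. the profile is nontrivial: $(V^r,V^{(3)})\not\equiv(0,0)$, or else $\Theta\not\equiv0$ and $W$ is bounded on all of $D\times[0,T_0)$ off the axis; 4. $|V^r(y)|+|V^{(3)}(y)|=o(|y|)$ as $|y|\to\infty$ in $\mathbb R^2_-$, and $\nabla V^r,\nabla V^{(3)}$ are bounded on $\mathbb R^2_-$; 5. $V^{(3)}$ is odd in the vertical variable: $V^{(3)}(y_1,-y_2)=-V^{(3)}(y_1,y_2)$. -/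

import Mathlib

open Set Filter Topology Asymptotics
open scoped NNReal ContDiff

/-- Physical space `ℝ³` with its Euclidean structure; the coordinates `x⁽¹⁾, x⁽²⁾, x⁽³⁾` are
`x 0, x 1, x 2`. -/
abbrev Space3 := EuclideanSpace ℝ (Fin 3)

namespace AxiEuler

noncomputable section

/-- The distance `r` to the vertical axis. -/
def radius (x : Space3) : ℝ := √(x 0 ^ 2 + x 1 ^ 2)

/-- The radial unit vector `e_r` (used off the axis; it is `0` on the axis). -/
def eR (x : Space3) : Space3 := !₂[x 0 / radius x, x 1 / radius x, 0]

/-- The angular unit vector `e_θ` (used off the axis; it is `0` on the axis). -/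
def eTheta (x : Space3) : Space3 := !₂[-(x 1) / radius x, x 0 / radius x, 0]

/-- The vertical unit vector `e_3`. -/
def eZ : Space3 := !₂[0, 0, 1]

/-- The boundary point `p₀` with cylindrical coordinates `(r, θ, x⁽³⁾) = (1, 0, 0)`. -/
def p0 : Space3 := !₂[1, 0, 0]

/-- The closed finite cylinder of radius `1` around the vertical axis, `a ≤ x⁽³⁾ ≤ b`. -/
def cylinder (a b : ℝ) : Set Space3 := {x | radius x ≤ 1 ∧ a ≤ x 2 ∧ x 2 ≤ b}

/-- Divergence of a vector field on `ℝ³`. -/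
def divergence (u : Space3 → Space3) (x : Space3) : ℝ :=
  ∑ i : Fin 3, fderiv ℝ u x (EuclideanSpace.single i 1) i

/-- `(v, p)` is a smooth axially symmetric solution of the incompressible Euler equations in the
cylinder `cylinder a b` on the time interval `[0, T₀)`, smooth up to the boundary and up to the
initial time, with no penetration through the side boundary and matching values of the velocity
on the top and on the bottom. -/
structure IsSmoothAxisymmetricEuler (a b T₀ : ℝ) (v : ℝ → Space3 → Space3)
    (p : ℝ → Space3 → ℝ) : Prop where
  smooth_velocity :
    ContDiffOn ℝ ∞ (fun q : Space3 × ℝ => v q.2 q.1) (cylinder a b ×ˢ Ico 0 T₀)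
  smooth_pressure :
    ContDiffOn ℝ ∞ (fun q : Space3 × ℝ => p q.2 q.1) (cylinder a b ×ˢ Ico 0 T₀)
  momentum : ∀ t ∈ Ioo 0 T₀, ∀ x ∈ interior (cylinder a b),
    deriv (fun s => v s x) t + fderiv ℝ (v t) x (v t x) + gradient (p t) x = 0
  incompressible : ∀ t ∈ Ioo 0 T₀, ∀ x ∈ interior (cylinder a b), divergence (v t) x = 0
  axisymmetric : ∃ vr vth vz : ℝ → ℝ → ℝ → ℝ, ∀ t ∈ Ico 0 T₀, ∀ x ∈ cylinder a b,
    v t x = vr t (radius x) (x 2) • eR x + vth t (radius x) (x 2) • eTheta x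
      + vz t (radius x) (x 2) • eZ
  no_penetration : ∀ t ∈ Ico 0 T₀, ∀ x ∈ cylinder a b, radius x = 1 →
    inner ℝ (v t x) (eR x) = 0
  periodic : ∀ t ∈ Ico 0 T₀, ∀ x ∈ cylinder a b, ∀ y ∈ cylinder a b,
    x 0 = y 0 → x 1 = y 1 → x 2 = a → y 2 = b → v t x = v t y

/-- The closed half plane in which the profiles live: the first variable is the rescaled
`r - 1 ≤ 0`, the second one the rescaled vertical variable `x⁽³⁾`. -/
def halfPlane : Set (ℝ × ℝ) := {y | y.1 ≤ 0}

/-- `F` is a local `C^{2,γ}` function on the closed half plane: it is `C²` up to the boundary and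
its second derivative is `γ`-Hölder on every compact subset. -/
def IsLocalC2Holder (γ : ℝ≥0) (F : ℝ × ℝ → ℝ) : Prop :=
  ContDiffOn ℝ 2 F halfPlane ∧
    ∀ K ⊆ halfPlane, IsCompact K →
      ∃ C : ℝ≥0, HolderOnWith C γ (iteratedFDerivWithin ℝ 2 F halfPlane) K

/-- Sub-linear growth at infinity in the half plane: `|F y| = o(|y|)`. -/
def IsSublinear (F : ℝ × ℝ → ℝ) : Prop :=
  F =o[Bornology.cobounded (ℝ × ℝ) ⊓ 𝓟 halfPlane] (fun y => y)

/-- The gradient of `F` is bounded on the half plane. -/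
def HasBoundedGradient (F : ℝ × ℝ → ℝ) : Prop :=
  ∃ M : ℝ, ∀ y ∈ halfPlane, ‖fderivWithin ℝ F halfPlane y‖ ≤ M

/-- The self-similar variable centred at `p₀`, in the `(r, x⁽³⁾)` plane. -/
def selfSimilarVar (α T₀ t : ℝ) (x : Space3) : ℝ × ℝ :=
  ((radius x - 1) / (T₀ - t) ^ (1 - α), x 2 / (T₀ - t) ^ (1 - α))

/-- `v` has the asymptotically self-similar form with exponents `α, β`, centre `p₀`, profile
`(Θ, Vr, V3)` and error `ε(t) (T₀ - t)^{-α} W(x, t)`, where `ε(t) → 0` as `t → T₀` and `W` is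
bounded near `(p₀, T₀)`. -/
structure IsAsymptoticallySelfSimilar (a b T₀ α β : ℝ) (v : ℝ → Space3 → Space3)
    (Θ Vr V3 : ℝ × ℝ → ℝ) (ε : ℝ → ℝ) (W : ℝ → Space3 → Space3) : Prop where
  ansatz : ∀ t ∈ Ico 0 T₀, ∀ x ∈ cylinder a b, 0 < radius x →
    v t x = (1 / (T₀ - t) ^ (α + β) * Θ (selfSimilarVar α T₀ t x)) • eTheta x
      + (1 / (T₀ - t) ^ α * Vr (selfSimilarVar α T₀ t x)) • eR x
      + (1 / (T₀ - t) ^ α * V3 (selfSimilarVar α T₀ t x)) • eZ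
      + (ε t / (T₀ - t) ^ α) • W t x
  small : Tendsto ε (𝓝[<] T₀) (𝓝 0)
  error_bounded_near : ∃ δ > 0, ∃ M : ℝ, ∀ t ∈ Ico 0 T₀, T₀ - δ < t →
    ∀ x ∈ cylinder a b, dist x p0 < δ → ‖W t x‖ ≤ M

/-- The error field is bounded on the whole space-time domain (off the axis, where the
cylindrical frame is defined). -/
def IsGloballyBounded (a b T₀ : ℝ) (W : ℝ → Space3 → Space3) : Prop :=
  ∃ M : ℝ, ∀ t ∈ Ico 0 T₀, ∀ x ∈ cylinder a b, 0 < radius x → ‖W t x‖ ≤ M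

/-- `F` does not vanish identically on the half plane. -/
def IsNontrivial (F : ℝ × ℝ → ℝ) : Prop := ∃ y ∈ halfPlane, F y ≠ 0

end

end AxiEuler

/-! Put τ = T₀ - t and c = 1 - α, and rescale the velocity on the half plane θ = 0 around p₀. Each
rescaled component F solves τ ∂_τ F = κ F + (c y + w) · ∇F + S, where w is the rescaled meridional
velocity and S collects pressure and curvature terms. The ansatz says that these components converge
to the profile uniformly on compact sets; nothing is known about their derivatives. So the equation
is tested against φ and all space derivatives are moved onto φ (`tendsto_weak_transport`). Then g(τ)
= ∫ F φ converges and τ g'(τ) converges as well, which forces the second limit to be 0, since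
otherwise g would diverge like log τ (`eq_zero_of_tendsto_mul_deriv`). Hence the profile solves the
stationary equation.

In the momentum equation the pressure has no known limit; testing with the divergence free field
(∂₂ψ, -∂₁ψ) removes it. The centrifugal term carries the factor τ^(1 - α - 2β), which tends to 0
exactly because of the inequality assumed on α and β. What remains is two-dimensional: (V^r, V^(3))
is divergence free, tangent to y₁ = 0, and its vorticity satisfies ω + (c y + V) · ∇ω = 0.

The vorticity is bounded, and the field c y + V points outward at infinity because V is sublinear. A
maximum principle for ω² / (1 + ε|y|²) gives ω = 0 (`eq_zero_of_transport`). Then V^r - i V^(3) is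
holomorphic, extends to an entire function by Schwarz reflection, and is constant by Liouville
(`eq_of_div_curl_free`). The boundary condition and oddness make the constant 0.

With V = 0 the swirl satisfies (α + β) Θ + c y · ∇Θ = 0, so it is homogeneous of degree -(α + β)/c <
1. Being C¹ at the origin, it is 0, or constant when α + β = 0 (`swirl_profile_eq_const`). A nonzero
constant contradicts the vanishing of the horizontal velocity on the axis, and this is where the
global bound on W enters (`BlowupData.swirl_eq_zero`). -/

namespace AxiEuler

open MeasureTheory

/-! ### Test functions and integration by parts in the plane -/

/-- The first partial derivative of a function on the plane. -/
noncomputable def dOne (f : ℝ × ℝ → ℝ) (y : ℝ × ℝ) : ℝ := fderiv ℝ f y (1, 0)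

/-- The second partial derivative of a function on the plane. -/
noncomputable def dTwo (f : ℝ × ℝ → ℝ) (y : ℝ × ℝ) : ℝ := fderiv ℝ f y (0, 1)

/-- The open half plane. -/
def openHalfPlane : Set (ℝ × ℝ) := {y | y.1 < 0}

/-- Smooth compactly supported test functions on `U`. -/
structure IsTest (U : Set (ℝ × ℝ)) (φ : ℝ × ℝ → ℝ) : Prop where
  smooth : ContDiff ℝ ∞ φ
  compact : HasCompactSupport φ
  subset : tsupport φ ⊆ U

theorem isOpen_openHalfPlane : IsOpen openHalfPlane := isOpen_lt continuous_fst continuous_const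

theorem contDiff_fderiv_apply {φ : ℝ × ℝ → ℝ} (h : ContDiff ℝ ∞ φ) (e : ℝ × ℝ) :
    ContDiff ℝ ∞ (fun y => fderiv ℝ φ y e) :=
  (h.fderiv_right (m := ∞) (by simp)).clm_apply contDiff_const

theorem tsupport_fderiv_apply (φ : ℝ × ℝ → ℝ) (e : ℝ × ℝ) :
    tsupport (fun y => fderiv ℝ φ y e) ⊆ tsupport φ :=
  tsupport_fderiv_apply_subset ℝ e

theorem IsTest.fderiv_apply {U : Set (ℝ × ℝ)} {φ : ℝ × ℝ → ℝ} (h : IsTest U φ) (e : ℝ × ℝ) :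
    IsTest U (fun y => fderiv ℝ φ y e) :=
  ⟨contDiff_fderiv_apply h.smooth e, h.compact.fderiv_apply (𝕜 := ℝ) e,
    (tsupport_fderiv_apply φ e).trans h.subset⟩

theorem IsTest.dOne {U : Set (ℝ × ℝ)} {φ : ℝ × ℝ → ℝ} (h : IsTest U φ) : IsTest U (dOne φ) :=
  h.fderiv_apply _

theorem IsTest.dTwo {U : Set (ℝ × ℝ)} {φ : ℝ × ℝ → ℝ} (h : IsTest U φ) : IsTest U (dTwo φ) :=
  h.fderiv_apply _

theorem IsTest.continuous {U : Set (ℝ × ℝ)} {φ : ℝ × ℝ → ℝ} (h : IsTest U φ) : Continuous φ :=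
  h.smooth.continuous

/-- A function continuous on a compact set and zero outside is integrable. -/
theorem integrable_of_continuousOn {K : Set (ℝ × ℝ)} (hK : IsCompact K) {f : ℝ × ℝ → ℝ}
    (hf : ContinuousOn f K) (h0 : ∀ y ∉ K, f y = 0) : Integrable f := by
  rw [← integrableOn_iff_integrable_of_support_subset (s := K)]
  · exact hf.integrableOn_compact hK
  · intro y hy
    by_contra h
    exact hy (h0 y h)

theorem integrable_mul_test {K : Set (ℝ × ℝ)} (hK : IsCompact K) {f φ : ℝ × ℝ → ℝ}
    (hf : ContinuousOn f K) (hφ : Continuous φ) (hs : tsupport φ ⊆ K) :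
    Integrable (fun y => f y * φ y) :=
  integrable_of_continuousOn hK (hf.mul hφ.continuousOn) fun y hy => by
    rw [image_eq_zero_of_notMem_tsupport fun h => hy (hs h), mul_zero]

theorem continuousOn_fderiv_apply {E : Type*} [NormedAddCommGroup E] [NormedSpace ℝ E]
    {f : E → ℝ} {K : Set E}
    (h : ∀ y ∈ K, ContDiffAt ℝ 1 f y) (e : E) : ContinuousOn (fun y => fderiv ℝ f y e) K :=
  fun y hy => (((h y hy).fderiv_right (m := 0) (by simp)).continuousAt.clm_apply
    continuousAt_const).continuousWithinAt

/-- Integration by parts against a test function. -/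
theorem integral_mul_fderiv_test {U : Set (ℝ × ℝ)} {φ f : ℝ × ℝ → ℝ} (hφ : IsTest U φ)
    (hf : ∀ y ∈ tsupport φ, ContDiffAt ℝ 1 f y) (e : ℝ × ℝ) :
    ∫ y, f y * fderiv ℝ φ y e = -∫ y, fderiv ℝ f y e * φ y := by
  have hc : ContinuousOn f (tsupport φ) := fun y hy => (hf y hy).continuousAt.continuousWithinAt
  apply integral_mul_fderiv_eq_neg_fderiv_mul_of_integrable
  · exact integrable_mul_test hφ.compact (continuousOn_fderiv_apply hf e) hφ.continuous le_rfl
  · exact integrable_mul_test hφ.compact hc (contDiff_fderiv_apply hφ.smooth e).continuous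
      (tsupport_fderiv_apply φ e)
  · exact integrable_mul_test hφ.compact hc hφ.continuous le_rfl
  · exact fun y hy => (hf y hy).differentiableAt (by simp)
  · exact fun y _ => (hφ.smooth.differentiable (by simp)) y

/-- The bracket on the left is div (f b). Keeping div b as a separate term is essential later: the
derivatives of the rescaled velocity do not converge individually, but its divergence does. -/
theorem integral_mul_transport {U : Set (ℝ × ℝ)} {φ f b₁ b₂ : ℝ × ℝ → ℝ} (hφ : IsTest U φ)
    (hf : ∀ y ∈ tsupport φ, ContDiffAt ℝ 1 f y)
    (h₁ : ∀ y ∈ tsupport φ, ContDiffAt ℝ 1 b₁ y)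
    (h₂ : ∀ y ∈ tsupport φ, ContDiffAt ℝ 1 b₂ y) :
    ∫ y, (b₁ y * dOne f y + b₂ y * dTwo f y + f y * (dOne b₁ y + dTwo b₂ y)) * φ y
      = -∫ y, f y * (b₁ y * dOne φ y + b₂ y * dTwo φ y) := by
  have hc {g : ℝ × ℝ → ℝ} (hg : ∀ y ∈ tsupport φ, ContDiffAt ℝ 1 g y) :
      ContinuousOn g (tsupport φ) := fun y hy => (hg y hy).continuousAt.continuousWithinAt
  have p₁ : ∀ y ∈ tsupport φ, ContDiffAt ℝ 1 (fun y => f y * b₁ y) y :=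
    fun y hy => (hf y hy).mul (h₁ y hy)
  have p₂ : ∀ y ∈ tsupport φ, ContDiffAt ℝ 1 (fun y => f y * b₂ y) y :=
    fun y hy => (hf y hy).mul (h₂ y hy)
  have i₁ := integral_mul_fderiv_test hφ p₁ (1, 0)
  have i₂ := integral_mul_fderiv_test hφ p₂ (0, 1)
  have e₁ : ∫ y, f y * (b₁ y * dOne φ y + b₂ y * dTwo φ y)
      = (∫ y, f y * b₁ y * fderiv ℝ φ y (1, 0)) + ∫ y, f y * b₂ y * fderiv ℝ φ y (0, 1) := by
    rw [← integral_add]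
    · congr 1; ext y; simp only [dOne, dTwo]; ring
    · exact integrable_mul_test hφ.compact (hc p₁) hφ.dOne.continuous (tsupport_fderiv_apply φ _)
    · exact integrable_mul_test hφ.compact (hc p₂) hφ.dTwo.continuous (tsupport_fderiv_apply φ _)
  have e₂ : ∫ y, (b₁ y * dOne f y + b₂ y * dTwo f y + f y * (dOne b₁ y + dTwo b₂ y)) * φ y
      = (∫ y, fderiv ℝ (fun y => f y * b₁ y) y (1, 0) * φ y)
        + ∫ y, fderiv ℝ (fun y => f y * b₂ y) y (0, 1) * φ y := by
    rw [← integral_add]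
    · congr 1; ext y
      by_cases hy : y ∈ tsupport φ
      · have q {g : ℝ × ℝ → ℝ} (hg : ∀ y ∈ tsupport φ, ContDiffAt ℝ 1 g y) :=
          (hg y hy).differentiableAt (by simp)
        rw [fderiv_fun_mul (q hf) (q h₁), fderiv_fun_mul (q hf) (q h₂)]
        simp only [dOne, dTwo, add_apply, smul_apply,
          smul_eq_mul]
        ring
      · simp [image_eq_zero_of_notMem_tsupport hy]
    · exact integrable_mul_test hφ.compact (continuousOn_fderiv_apply p₁ _) hφ.continuous le_rfl
    · exact integrable_mul_test hφ.compact (continuousOn_fderiv_apply p₂ _) hφ.continuous le_rfl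
  rw [e₁, e₂, i₁, i₂]
  ring

/-- Gradients are orthogonal to perpendicular gradients of test functions. -/
theorem integral_grad_mul_perp {U : Set (ℝ × ℝ)} {ψ P : ℝ × ℝ → ℝ} (hψ : IsTest U ψ)
    (hP : ∀ y ∈ tsupport ψ, ContDiffAt ℝ 1 P y) :
    (∫ y, dOne P y * dTwo ψ y) - ∫ y, dTwo P y * dOne ψ y = 0 := by
  have i₁ := integral_mul_fderiv_test hψ.dTwo
    (fun y hy => hP y (tsupport_fderiv_apply ψ _ hy)) (1, 0)
  have i₂ := integral_mul_fderiv_test hψ.dOne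
    (fun y hy => hP y (tsupport_fderiv_apply ψ _ hy)) (0, 1)
  -- Symmetry of the second derivative of ψ: after moving both derivatives onto ψ the two integrals
  -- coincide, and P needs only one derivative.
  have : (fun y => P y * fderiv ℝ (dTwo ψ) y (1, 0)) = fun y => P y * fderiv ℝ (dOne ψ) y (0, 1) := by
    ext y
    have hd : DifferentiableAt ℝ (fderiv ℝ ψ) y :=
      ((hψ.smooth.fderiv_right (m := ∞) (by simp)).differentiable (by simp)) y
    have hs := (hψ.smooth.contDiffAt (x := y)).isSymmSndFDerivAt
      (by simpa using WithTop.coe_le_coe.2 (le_top : (2 : ℕ∞) ≤ ⊤)) (1, 0) (0, 1)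
    unfold dOne dTwo
    rw [fderiv_clm_apply hd (by fun_prop), fderiv_clm_apply hd (by fun_prop)]
    simpa using Or.inl hs
  rw [this] at i₁
  unfold dOne dTwo at *
  linarith

theorem eqOn_zero_of_integral_test {U : Set (ℝ × ℝ)} (hU : IsOpen U) {f : ℝ × ℝ → ℝ}
    (hf : ContinuousOn f U) (h : ∀ φ, IsTest U φ → ∫ y, f y * φ y = 0) : ∀ y ∈ U, f y = 0 := by
  have h1 := hU.ae_eq_zero_of_integral_contDiff_smul_eq_zero (μ := volume)
    (hf.locallyIntegrableOn hU.measurableSet)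
    (fun g hg hc hs => by simpa [mul_comm] using h g ⟨hg, hc, hs⟩)
  have h2 : f =ᵐ[volume.restrict U] 0 := (ae_restrict_iff' hU.measurableSet).2 h1
  exact fun y hy => Measure.eqOn_open_of_ae_eq h2 hU hf continuousOn_const hy

/-! ### Uniform limits on compact sets, under products and integrals -/

theorem TendstoUniformlyOn.mul_of_bounded {ι X : Type*} {l : Filter ι} {F G : ι → X → ℝ}
    {f g : X → ℝ} {K : Set X} (hF : TendstoUniformlyOn F f l K) (hG : TendstoUniformlyOn G g l K)
    {A B : ℝ} (hf : ∀ x ∈ K, |f x| ≤ A) (hg : ∀ x ∈ K, |g x| ≤ B) :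
    TendstoUniformlyOn (fun i x => F i x * G i x) (fun x => f x * g x) l K := by
  rw [Metric.tendstoUniformlyOn_iff] at *
  intro ε hε
  have hC : 0 < |A| + |B| + 1 := by positivity
  set δ := min 1 (ε / (|A| + |B| + 1)) with hδ
  have hδ0 : 0 < δ := lt_min one_pos (by positivity)
  have hδε : δ * (|A| + |B| + 1) ≤ ε :=
    (mul_le_mul_of_nonneg_right (min_le_right _ _) hC.le).trans_eq (div_mul_cancel₀ _ hC.ne')
  filter_upwards [hF δ hδ0, hG δ hδ0] with i h₁ h₂ x hx
  have a₁ := h₁ x hx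
  have a₂ := h₂ x hx
  rw [Real.dist_eq] at *
  have b₁ := (hf x hx).trans (le_abs_self A)
  have b₂ := (hg x hx).trans (le_abs_self B)
  have hG1 : |G i x| ≤ |B| + δ := by
    have : G i x = g x - (g x - G i x) := by ring
    rw [this]
    exact (abs_sub _ _).trans (by linarith)
  have : f x * g x - F i x * G i x = f x * (g x - G i x) + (f x - F i x) * G i x := by ring
  rw [this]
  have hδ1 : δ ≤ 1 := min_le_left _ _
  calc _ ≤ |f x| * |g x - G i x| + |f x - F i x| * |G i x| := by
        rw [← abs_mul, ← abs_mul]; exact abs_add_le _ _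
    _ < δ * (|A| + |B| + 1) := by
        rcases (abs_nonneg (f x - F i x)).eq_or_lt with h | h
        · rw [← h]
          nlinarith [abs_nonneg (f x), abs_nonneg (g x - G i x), abs_nonneg B]
        · nlinarith [abs_nonneg (f x), abs_nonneg (g x - G i x), abs_nonneg B,
            abs_nonneg (G i x)]
    _ ≤ ε := hδε

theorem tendsto_integral_mul_of_tendstoUniformlyOn {l : Filter ℝ} [l.IsCountablyGenerated]
    {K : Set (ℝ × ℝ)} (hK : IsCompact K) {F : ℝ → ℝ × ℝ → ℝ} {f φ : ℝ × ℝ → ℝ}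
    (hF : TendstoUniformlyOn F f l K) (hFc : ∀ᶠ τ in l, ContinuousOn (F τ) K)
    (hf : ContinuousOn f K) (hφ : Continuous φ) (hs : tsupport φ ⊆ K) :
    Tendsto (fun τ => ∫ y, F τ y * φ y) l (𝓝 (∫ y, f y * φ y)) := by
  have hz : ∀ y ∉ K, φ y = 0 := fun y hy => image_eq_zero_of_notMem_tsupport fun h => hy (hs h)
  -- Dominating function: eventually F τ is within 1 of f on the whole of K.
  have hi : Integrable (fun y => (|f y| + 1) * |φ y|) := by
    refine integrable_of_continuousOn hK ((hf.abs.add continuousOn_const).mul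
      hφ.abs.continuousOn) fun y hy => by simp [hz y hy]
  refine tendsto_integral_filter_of_dominated_convergence _ ?_ ?_ hi ?_
  · filter_upwards [hFc] with τ hτ
    exact (integrable_mul_test hK hτ hφ hs).aestronglyMeasurable
  · filter_upwards [Metric.tendstoUniformlyOn_iff.1 hF 1 one_pos] with τ hτ
    refine Eventually.of_forall fun y => ?_
    by_cases hy : y ∈ K
    · rw [norm_mul, Real.norm_eq_abs, Real.norm_eq_abs]
      refine mul_le_mul_of_nonneg_right ?_ (abs_nonneg _)
      have := hτ y hy
      rw [Real.dist_eq] at this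
      have h2 : F τ y = f y - (f y - F τ y) := by ring
      rw [h2]
      exact (abs_sub _ _).trans (by linarith)
    · simp [hz y hy]
  · refine Eventually.of_forall fun y => ?_
    by_cases hy : y ∈ K
    · exact (hF.tendsto_at hy).mul_const _
    · simpa [hz y hy] using tendsto_const_nhds

/-! ### Stationary limit of the rescaled transport equation -/

/-- If `g` has a limit at `0⁺` and `τ g'(τ)` has a limit, then the latter is `0`. -/
theorem eq_zero_of_tendsto_mul_deriv {g g' : ℝ → ℝ} {c L τ₀ : ℝ} (hτ₀ : 0 < τ₀)
    (hg : ∀ τ ∈ Ioo 0 τ₀, HasDerivAt g (g' τ) τ) (hc : Tendsto g (𝓝[>] 0) (𝓝 c))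
    (hL : Tendsto (fun τ => τ * g' τ) (𝓝[>] 0) (𝓝 L)) : L = 0 := by
  by_contra hne
  have hL0 : 0 < |L| := abs_pos.2 hne
  have hd : Tendsto (fun τ : ℝ => 2 * τ) (𝓝[>] 0) (𝓝[>] 0) := by
    refine tendsto_nhdsWithin_iff.2 ⟨?_, ?_⟩
    · have : Tendsto (fun τ : ℝ => 2 * τ) (𝓝 0) (𝓝 (2 * 0)) := by
        exact (continuous_const.mul continuous_id).tendsto 0
      rw [mul_zero] at this
      exact this.mono_left nhdsWithin_le_nhds
    · filter_upwards [self_mem_nhdsWithin] with τ hτ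
      exact mul_pos two_pos (mem_Ioi.1 hτ)
  have h1 : Tendsto (fun τ => g (2 * τ) - g τ) (𝓝[>] 0) (𝓝 0) := by
    simpa using (hc.comp hd).sub hc
  have h2 : ∀ᶠ τ in 𝓝[>] (0 : ℝ), |L| / 2 < |τ * g' τ| :=
    hL.abs.eventually_const_lt (by linarith)
  obtain ⟨δ, hδ, hδ'⟩ := mem_nhdsGT_iff_exists_Ioo_subset.1 h2
  have hδ0 : (0 : ℝ) < δ := hδ
  have h3 : ∀ᶠ τ in 𝓝[>] (0 : ℝ), |g (2 * τ) - g τ| < |L| / 4 := by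
    have := h1.abs
    rw [abs_zero] at this
    exact this.eventually_lt_const (by linarith)
  have h4 : ∀ᶠ τ in 𝓝[>] (0 : ℝ), τ ∈ Ioo 0 (min δ τ₀ / 2) :=
    Ioo_mem_nhdsGT (by have := lt_min hδ0 hτ₀; linarith)
  obtain ⟨τ, hτ3, hτ0, hτ⟩ := (h3.and h4).exists
  have hτδ : 2 * τ < δ := by have := min_le_left δ τ₀; linarith
  have hττ : 2 * τ < τ₀ := by have := min_le_right δ τ₀; linarith
  -- Mean value theorem on [τ, 2τ]: since ξ < 2τ, the increment τ g'(ξ) exceeds half of ξ g'(ξ) in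
  -- absolute value, hence |L|/4. But g(2τ) - g(τ) tends to 0.
  obtain ⟨ξ, ⟨hξ1, hξ2⟩, hξ⟩ := exists_hasDerivAt_eq_slope g g' (show τ < 2 * τ by linarith)
    (fun x hx => (hg x ⟨by linarith [hx.1], by linarith [hx.2]⟩).continuousAt.continuousWithinAt)
    (fun x hx => hg x ⟨by linarith [hx.1], by linarith [hx.2]⟩)
  have h5 : |L| / 2 < |ξ * g' ξ| := hδ' ⟨by linarith, by linarith⟩
  have h6 : τ * g' ξ = g (2 * τ) - g τ := by
    rw [hξ]; field_simp; ring
  rw [abs_mul, abs_of_pos (by linarith : (0 : ℝ) < ξ)] at h5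
  rw [← h6, abs_mul, abs_of_pos hτ0] at hτ3
  nlinarith [abs_nonneg (g' ξ)]

theorem hasDerivAt_integral_test {U : Set (ℝ × ℝ)} {φ : ℝ × ℝ → ℝ} (hφ : IsTest U φ)
    {F : ℝ × ℝ × ℝ → ℝ} {τ₀ : ℝ}
    (hF : ∀ τ ∈ Ioo 0 τ₀, ∀ y ∈ tsupport φ, ContDiffAt ℝ 1 F (τ, y)) {τ : ℝ} (hτ : τ ∈ Ioo 0 τ₀) :
    HasDerivAt (fun τ => ∫ y, F (τ, y) * φ y) (∫ y, fderiv ℝ F (τ, y) (1, 0) * φ y) τ := by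
  obtain ⟨τ₁, h1, h1'⟩ := exists_between hτ.1
  obtain ⟨τ₂, h2, h2'⟩ := exists_between hτ.2
  have hsub : Icc τ₁ τ₂ ⊆ Ioo 0 τ₀ := fun x hx => ⟨h1.trans_le hx.1, hx.2.trans_lt h2'⟩
  have hK : IsCompact (Icc τ₁ τ₂ ×ˢ tsupport φ) := isCompact_Icc.prod hφ.compact
  obtain ⟨C, hC⟩ := hK.exists_bound_of_continuousOn
    (continuousOn_fderiv_apply (f := F) (fun q hq => hF q.1 (hsub hq.1) q.2 hq.2) (1, 0))
  have hz : ∀ y ∉ tsupport φ, φ y = 0 := fun y hy => image_eq_zero_of_notMem_tsupport hy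
  have hFc : ∀ σ ∈ Ioo 0 τ₀, ContinuousOn (fun y => F (σ, y)) (tsupport φ) := fun σ hσ y hy =>
    ((hF σ hσ y hy).continuousAt.comp (f := fun y => (σ, y)) (by fun_prop)).continuousWithinAt
  have hF'c : ContinuousOn (fun y => fderiv ℝ F (τ, y) (1, 0)) (tsupport φ) :=
    (continuousOn_fderiv_apply (f := F) (K := Ioo 0 τ₀ ×ˢ tsupport φ)
      (fun q hq => hF q.1 hq.1 q.2 hq.2) (1, 0)).comp (f := fun y => (τ, y)) (by fun_prop)
      fun y hy => ⟨hτ, hy⟩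
  refine (hasDerivAt_integral_of_dominated_loc_of_deriv_le (s := Icc τ₁ τ₂)
    (F := fun τ y => F (τ, y) * φ y) (F' := fun τ y => fderiv ℝ F (τ, y) (1, 0) * φ y)
    (bound := fun y => C * |φ y|)
    (Icc_mem_nhds h1' h2) ?_ ?_ ?_ ?_ ?_ ?_).2
  · filter_upwards [Ioo_mem_nhds hτ.1 hτ.2] with σ hσ
    exact (integrable_mul_test hφ.compact (hFc σ hσ) hφ.continuous le_rfl).aestronglyMeasurable
  · exact integrable_mul_test hφ.compact (hFc τ hτ) hφ.continuous le_rfl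
  · exact (integrable_mul_test hφ.compact hF'c hφ.continuous le_rfl).aestronglyMeasurable
  · refine Eventually.of_forall fun y σ hσ => ?_
    by_cases hy : y ∈ tsupport φ
    · rw [norm_mul]
      exact mul_le_mul_of_nonneg_right (hC (σ, y) ⟨hσ, hy⟩) (abs_nonneg _)
    · simp [hz y hy]
  · exact integrable_of_continuousOn hφ.compact (f := fun y => C * |φ y|)
      ((continuous_const.mul hφ.continuous.abs).continuousOn) fun y hy => by simp [hz y hy]
  · refine Eventually.of_forall fun y σ hσ => ?_
    by_cases hy : y ∈ tsupport φ
    · have h := ((hF σ (hsub hσ) y hy).differentiableAt (by simp)).hasFDerivAt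
      have h' : HasDerivAt (fun σ : ℝ => (σ, y)) ((1 : ℝ), (0 : ℝ × ℝ)) σ :=
        (hasDerivAt_id σ).prodMk (hasDerivAt_const σ y)
      exact (h.comp_hasDerivAt σ h').mul_const _
    · simpa [hz y hy] using hasDerivAt_const σ (0 : ℝ)

theorem contDiffAt_slice {F : ℝ × ℝ × ℝ → ℝ} {τ : ℝ} {y : ℝ × ℝ} {n : WithTop ℕ∞}
    (h : ContDiffAt ℝ n F (τ, y)) :
    ContDiffAt ℝ n (fun y => F (τ, y)) y :=
  h.comp (f := fun y => (τ, y)) y (by fun_prop)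

theorem dOne_const_mul_fst_add {w : ℝ × ℝ → ℝ} {y : ℝ × ℝ} (c : ℝ)
    (h : DifferentiableAt ℝ w y) : dOne (fun y => c * y.1 + w y) y = c + dOne w y := by
  have : HasFDerivAt (fun y : ℝ × ℝ => c * y.1 + w y)
    (c • ContinuousLinearMap.fst ℝ ℝ ℝ + fderiv ℝ w y) y :=
    (hasFDerivAt_fst.const_mul c).add h.hasFDerivAt
  simp [dOne, this.fderiv]

theorem dTwo_const_mul_snd_add {w : ℝ × ℝ → ℝ} {y : ℝ × ℝ} (c : ℝ)
    (h : DifferentiableAt ℝ w y) : dTwo (fun y => c * y.2 + w y) y = c + dTwo w y := by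
  have : HasFDerivAt (fun y : ℝ × ℝ => c * y.2 + w y)
    (c • ContinuousLinearMap.snd ℝ ℝ ℝ + fderiv ℝ w y) y :=
    (hasFDerivAt_snd.const_mul c).add h.hasFDerivAt
  simp [dTwo, this.fderiv]

/-- Passage to the limit in the weak form of the transport equation
`τ ∂_τ F = κ F + (c y + w) · ∇F + S`. -/
theorem tendsto_weak_transport {φ : ℝ × ℝ → ℝ} (hφ : IsTest openHalfPlane φ)
    {F w₁ w₂ : ℝ × ℝ × ℝ → ℝ} {S : ℝ → ℝ × ℝ → ℝ} {F₀ V₁ V₂ : ℝ × ℝ → ℝ} {κ c τ₀ : ℝ}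
    (hτ₀ : 0 < τ₀)
    (hF : ∀ τ ∈ Ioo 0 τ₀, ∀ y ∈ tsupport φ, ContDiffAt ℝ 1 F (τ, y))
    (hw₁ : ∀ τ ∈ Ioo 0 τ₀, ∀ y ∈ tsupport φ, ContDiffAt ℝ 1 w₁ (τ, y))
    (hw₂ : ∀ τ ∈ Ioo 0 τ₀, ∀ y ∈ tsupport φ, ContDiffAt ℝ 1 w₂ (τ, y))
    (hpde : ∀ τ ∈ Ioo 0 τ₀, ∀ y ∈ tsupport φ, τ * fderiv ℝ F (τ, y) (1, 0)
      = κ * F (τ, y) + (c * y.1 + w₁ (τ, y)) * dOne (fun y => F (τ, y)) y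
        + (c * y.2 + w₂ (τ, y)) * dTwo (fun y => F (τ, y)) y + S τ y)
    (hF₀ : ∀ y ∈ openHalfPlane, ContDiffAt ℝ 1 F₀ y)
    (hV₁ : ∀ y ∈ openHalfPlane, ContDiffAt ℝ 1 V₁ y)
    (hV₂ : ∀ y ∈ openHalfPlane, ContDiffAt ℝ 1 V₂ y)
    (hdiv : ∀ y ∈ openHalfPlane, dOne V₁ y + dTwo V₂ y = 0)
    (lF : TendstoUniformlyOn (fun τ y => F (τ, y)) F₀ (𝓝[>] 0) (tsupport φ))
    (l₁ : TendstoUniformlyOn (fun τ y => w₁ (τ, y)) V₁ (𝓝[>] 0) (tsupport φ))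
    (l₂ : TendstoUniformlyOn (fun τ y => w₂ (τ, y)) V₂ (𝓝[>] 0) (tsupport φ))
    (lD : TendstoUniformlyOn
      (fun τ y => dOne (fun y => w₁ (τ, y)) y + dTwo (fun y => w₂ (τ, y)) y)
      (fun _ => 0) (𝓝[>] 0) (tsupport φ)) :
    Tendsto (fun τ => ∫ y, F (τ, y) * φ y) (𝓝[>] 0) (𝓝 (∫ y, F₀ y * φ y)) ∧
    Tendsto (fun τ => τ * (∫ y, fderiv ℝ F (τ, y) (1, 0) * φ y) - ∫ y, S τ y * φ y) (𝓝[>] 0)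
      (𝓝 (∫ y, (κ * F₀ y + (c * y.1 + V₁ y) * dOne F₀ y + (c * y.2 + V₂ y) * dTwo F₀ y) * φ y)) := by
  set K := tsupport φ with hKdef
  have hK : IsCompact K := hφ.compact
  have hsm : ∀ᶠ τ in 𝓝[>] (0 : ℝ), τ ∈ Ioo 0 τ₀ := Ioo_mem_nhdsGT hτ₀
  have hc₀ {g : ℝ × ℝ → ℝ} (hg : ∀ y ∈ openHalfPlane, ContDiffAt ℝ 1 g y) : ContinuousOn g K :=
    fun y hy => (hg y (hφ.subset hy)).continuousAt.continuousWithinAt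
  have hcs {g : ℝ × ℝ × ℝ → ℝ} (hg : ∀ τ ∈ Ioo 0 τ₀, ∀ y ∈ K, ContDiffAt ℝ 1 g (τ, y))
      {τ : ℝ} (hτ : τ ∈ Ioo 0 τ₀) : ContinuousOn (fun y => g (τ, y)) K :=
    fun y hy => (contDiffAt_slice (hg τ hτ y hy)).continuousAt.continuousWithinAt
  have hbd {g : ℝ × ℝ → ℝ} (hg : ContinuousOn g K) : ∃ C, ∀ y ∈ K, |g y| ≤ C :=
    hK.exists_bound_of_continuousOn hg
  have hlin (i : ℝ × ℝ → ℝ) {G : ℝ → ℝ × ℝ → ℝ} {g : ℝ × ℝ → ℝ}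
      (h : TendstoUniformlyOn G g (𝓝[>] 0) K) :
      TendstoUniformlyOn (fun τ y => i y + G τ y) (fun y => i y + g y) (𝓝[>] 0) K := by
    rw [Metric.tendstoUniformlyOn_iff] at *
    simpa using h
  -- the limits of the three groups of terms
  have cF₀ := hc₀ hF₀
  have cb₁ : ContinuousOn (fun y => c * y.1 + V₁ y) K := by have := hc₀ hV₁; fun_prop
  have cb₂ : ContinuousOn (fun y => c * y.2 + V₂ y) K := by have := hc₀ hV₂; fun_prop
  obtain ⟨A, hA⟩ := hbd cF₀
  obtain ⟨B₁, hB₁⟩ := hbd cb₁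
  obtain ⟨B₂, hB₂⟩ := hbd cb₂
  have t₁ := tendsto_integral_mul_of_tendstoUniformlyOn hK
    (TendstoUniformlyOn.mul_of_bounded lF (hlin (fun y => c * y.1) l₁) hA hB₁)
    (by filter_upwards [hsm] with τ hτ
        exact (hcs hF hτ).mul ((continuousOn_fst.const_mul c).add (hcs hw₁ hτ))) (cF₀.mul cb₁)
    hφ.dOne.continuous (tsupport_fderiv_apply φ _)
  have t₂ := tendsto_integral_mul_of_tendstoUniformlyOn hK
    (TendstoUniformlyOn.mul_of_bounded lF (hlin (fun y => c * y.2) l₂) hA hB₂)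
    (by filter_upwards [hsm] with τ hτ
        exact (hcs hF hτ).mul ((continuousOn_snd.const_mul c).add (hcs hw₂ hτ))) (cF₀.mul cb₂)
    hφ.dTwo.continuous (tsupport_fderiv_apply φ _)
  have cD : ∀ τ ∈ Ioo 0 τ₀, ContinuousOn
      (fun y => dOne (fun y => w₁ (τ, y)) y + dTwo (fun y => w₂ (τ, y)) y) K := fun τ hτ =>
    (continuousOn_fderiv_apply (fun y hy => (contDiffAt_slice (hw₁ τ hτ y hy))) _).add
      (continuousOn_fderiv_apply (fun y hy => (contDiffAt_slice (hw₂ τ hτ y hy))) _)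
  -- With b = c y + w one has div b = 2c + div w in the plane, so the equation reads τ ∂_τ F - S + F
  -- (2c - κ + div w) = div (F b). The three limits are those of the two flux terms and of this
  -- zeroth order term.
  have t₃ := tendsto_integral_mul_of_tendstoUniformlyOn hK
    (TendstoUniformlyOn.mul_of_bounded lF (hlin (fun _ => 2 * c - κ) lD) hA
      (B := |2 * c - κ + 0|) (fun _ _ => le_rfl))
    (by filter_upwards [hsm] with τ hτ
        exact (hcs hF hτ).mul (continuousOn_const.add (cD τ hτ))) (cF₀.mul continuousOn_const)
    hφ.continuous le_rfl
  refine ⟨tendsto_integral_mul_of_tendstoUniformlyOn hK lF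
    (by filter_upwards [hsm] with τ hτ using hcs hF hτ) cF₀ hφ.continuous le_rfl, ?_⟩
  have key := (t₁.add (t₂.add t₃)).neg
  refine (key.congr' ?_).trans_eq ?_
  · filter_upwards [hsm] with τ hτ
    have hb₁ : ∀ y ∈ K, ContDiffAt ℝ 1 (fun y : ℝ × ℝ => c * y.1 + w₁ (τ, y)) y := fun y hy => by
      exact (contDiffAt_fst.const_smul c).add (contDiffAt_slice (hw₁ τ hτ y hy))
    have hb₂ : ∀ y ∈ K, ContDiffAt ℝ 1 (fun y : ℝ × ℝ => c * y.2 + w₂ (τ, y)) y := fun y hy => by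
      exact (contDiffAt_snd.const_smul c).add (contDiffAt_slice (hw₂ τ hτ y hy))
    have hFτ : ∀ y ∈ K, ContDiffAt ℝ 1 (fun y => F (τ, y)) y := fun y hy => (contDiffAt_slice (hF τ hτ y hy))
    have ib := integral_mul_transport hφ hFτ hb₁ hb₂
    have i₁ := integrable_mul_test hK (f := fun y => F (τ, y) * (c * y.1 + w₁ (τ, y)))
      (by exact (hcs hF hτ).mul ((continuousOn_fst.const_mul c).add (hcs hw₁ hτ)))
      hφ.dOne.continuous (tsupport_fderiv_apply φ _)
    have i₂ := integrable_mul_test hK (f := fun y => F (τ, y) * (c * y.2 + w₂ (τ, y)))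
      (by exact (hcs hF hτ).mul ((continuousOn_snd.const_mul c).add (hcs hw₂ hτ)))
      hφ.dTwo.continuous (tsupport_fderiv_apply φ _)
    have i₃ := integrable_mul_test hK (f := fun y => F (τ, y) * (2 * c - κ
      + (dOne (fun y => w₁ (τ, y)) y + dTwo (fun y => w₂ (τ, y)) y)))
      (by exact (hcs hF hτ).mul (continuousOn_const.add (cD τ hτ)))
      hφ.continuous le_rfl
    have cdt : ContinuousOn (fun y => fderiv ℝ F (τ, y) (1, 0)) K :=
      (continuousOn_fderiv_apply (f := F) (K := Ioo 0 τ₀ ×ˢ K)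
        (fun q hq => hF q.1 hq.1 q.2 hq.2) (1, 0)).comp (f := fun y => (τ, y)) (by fun_prop)
        fun y hy => ⟨hτ, hy⟩
    have cd₁ := continuousOn_fderiv_apply hFτ (1, 0)
    have cd₂ := continuousOn_fderiv_apply hFτ (0, 1)
    have i₄ := integrable_mul_test hK (cdt.const_mul τ) hφ.continuous le_rfl
    -- No regularity of S is assumed; the equation itself expresses S by continuous functions on the
    -- support of φ.
    have i₅ : Integrable (fun y => S τ y * φ y) := by
      refine integrable_mul_test hK ?_ hφ.continuous le_rfl
      have : ContinuousOn (fun y => τ * fderiv ℝ F (τ, y) (1, 0)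
        - (κ * F (τ, y) + (c * y.1 + w₁ (τ, y)) * fderiv ℝ (fun y => F (τ, y)) y (1, 0)
        + (c * y.2 + w₂ (τ, y)) * fderiv ℝ (fun y => F (τ, y)) y (0, 1))) K := by
        exact (cdt.const_mul τ).sub ((((hcs hF hτ).const_mul κ).add
          (((continuousOn_fst.const_mul c).add (hcs hw₁ hτ)).mul cd₁)).add
          (((continuousOn_snd.const_mul c).add (hcs hw₂ hτ)).mul cd₂))
      refine this.congr fun y hy => ?_
      have := hpde τ hτ y hy
      simp only [dOne, dTwo] at this ⊢
      linarith
    have e₁ : ∫ y, F (τ, y) * ((c * y.1 + w₁ (τ, y)) * dOne φ y + (c * y.2 + w₂ (τ, y)) * dTwo φ y)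
        = (∫ y, F (τ, y) * (c * y.1 + w₁ (τ, y)) * dOne φ y)
          + ∫ y, F (τ, y) * (c * y.2 + w₂ (τ, y)) * dTwo φ y := by
      rw [← integral_add i₁ i₂]
      congr 1; ext y; ring
    have e₂ : τ * (∫ y, fderiv ℝ F (τ, y) (1, 0) * φ y) - ∫ y, S τ y * φ y
        = ∫ y, (τ * fderiv ℝ F (τ, y) (1, 0) * φ y - S τ y * φ y) := by
      rw [integral_sub i₄ i₅, ← integral_const_mul]
      congr 2; ext y; ring
    have e₃ : (∫ y, (τ * fderiv ℝ F (τ, y) (1, 0) * φ y - S τ y * φ y))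
        + ∫ y, F (τ, y) * (2 * c - κ
          + (dOne (fun y => w₁ (τ, y)) y + dTwo (fun y => w₂ (τ, y)) y)) * φ y
        = ∫ y, ((c * y.1 + w₁ (τ, y)) * dOne (fun y => F (τ, y)) y
          + (c * y.2 + w₂ (τ, y)) * dTwo (fun y => F (τ, y)) y
          + F (τ, y) * (dOne (fun y : ℝ × ℝ => c * y.1 + w₁ (τ, y)) y
            + dTwo (fun y : ℝ × ℝ => c * y.2 + w₂ (τ, y)) y)) * φ y := by
      have i₆ : Integrable (fun y => τ * fderiv ℝ F (τ, y) (1, 0) * φ y - S τ y * φ y) :=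
        i₄.sub i₅
      rw [← integral_add i₆ i₃]
      congr 1; ext y
      by_cases hy : y ∈ K
      · rw [dOne_const_mul_fst_add c ((contDiffAt_slice (hw₁ τ hτ y hy)).differentiableAt (by simp)),
          dTwo_const_mul_snd_add c ((contDiffAt_slice (hw₂ τ hτ y hy)).differentiableAt (by simp)),
          hpde τ hτ y hy]
        ring
      · simp [image_eq_zero_of_notMem_tsupport hy]
    rw [e₂]
    rw [ib, e₁] at e₃
    linarith
  -- The limit of the fluxes is turned back into the strong form by the same integration by parts,
  -- now for the profile, with div V = 0.
  · congr 1
    have hb₁ : ∀ y ∈ K, ContDiffAt ℝ 1 (fun y : ℝ × ℝ => c * y.1 + V₁ y) y := fun y hy => by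
      have := hV₁ y (hφ.subset hy); fun_prop
    have hb₂ : ∀ y ∈ K, ContDiffAt ℝ 1 (fun y : ℝ × ℝ => c * y.2 + V₂ y) y := fun y hy => by
      have := hV₂ y (hφ.subset hy); fun_prop
    have ib := integral_mul_transport hφ (fun y hy => hF₀ y (hφ.subset hy)) hb₁ hb₂
    have e₁ : ∫ y, F₀ y * ((c * y.1 + V₁ y) * dOne φ y + (c * y.2 + V₂ y) * dTwo φ y)
        = (∫ y, F₀ y * (c * y.1 + V₁ y) * dOne φ y)
          + ∫ y, F₀ y * (c * y.2 + V₂ y) * dTwo φ y := by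
      rw [← integral_add
        (integrable_mul_test hK (f := fun y => F₀ y * (c * y.1 + V₁ y)) (cF₀.mul cb₁)
          hφ.dOne.continuous (tsupport_fderiv_apply φ _))
        (integrable_mul_test hK (f := fun y => F₀ y * (c * y.2 + V₂ y)) (cF₀.mul cb₂)
          hφ.dTwo.continuous (tsupport_fderiv_apply φ _))]
      congr 1; ext y; ring
    have cd₁ := continuousOn_fderiv_apply (fun y (hy : y ∈ K) => hF₀ y (hφ.subset hy)) (1, 0)
    have cd₂ := continuousOn_fderiv_apply (fun y (hy : y ∈ K) => hF₀ y (hφ.subset hy)) (0, 1)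
    have j₁ := integrable_mul_test hK (f := fun y => κ * F₀ y + (c * y.1 + V₁ y) * dOne F₀ y
      + (c * y.2 + V₂ y) * dTwo F₀ y) (((cF₀.const_mul κ).add (cb₁.mul cd₁)).add (cb₂.mul cd₂))
      hφ.continuous le_rfl
    have j₂ := integrable_mul_test hK (f := fun y => F₀ y * (2 * c - κ + 0))
      (cF₀.mul continuousOn_const) hφ.continuous le_rfl
    have e₃ : (∫ y, (κ * F₀ y + (c * y.1 + V₁ y) * dOne F₀ y + (c * y.2 + V₂ y) * dTwo F₀ y) * φ y)
        + ∫ y, F₀ y * (2 * c - κ + 0) * φ y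
        = ∫ y, ((c * y.1 + V₁ y) * dOne F₀ y + (c * y.2 + V₂ y) * dTwo F₀ y
          + F₀ y * (dOne (fun y : ℝ × ℝ => c * y.1 + V₁ y) y
            + dTwo (fun y : ℝ × ℝ => c * y.2 + V₂ y) y)) * φ y := by
      rw [← integral_add j₁ j₂]
      congr 1; ext y
      by_cases hy : y ∈ K
      · have hd := hdiv y (hφ.subset hy)
        rw [dOne_const_mul_fst_add c ((hV₁ y (hφ.subset hy)).differentiableAt (by simp)),
          dTwo_const_mul_snd_add c ((hV₂ y (hφ.subset hy)).differentiableAt (by simp))]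
        linear_combination (-F₀ y * φ y) * hd
      · simp [image_eq_zero_of_notMem_tsupport hy]
    rw [ib, e₁] at e₃
    linarith

/-! ### From weak to pointwise equations for the profile -/

theorem contDiffAt_fderiv_apply {f : ℝ × ℝ → ℝ} {y : ℝ × ℝ} (h : ContDiffAt ℝ 2 f y)
    (e : ℝ × ℝ) : ContDiffAt ℝ 1 (fun y => fderiv ℝ f y e) y :=
  (h.fderiv_right (m := 1) (by norm_num)).clm_apply contDiffAt_const

theorem dOne_dTwo_comm {f : ℝ × ℝ → ℝ} {y : ℝ × ℝ} (h : ContDiffAt ℝ 2 f y) :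
    dOne (dTwo f) y = dTwo (dOne f) y := by
  have hd : DifferentiableAt ℝ (fderiv ℝ f) y :=
    (h.fderiv_right (m := 1) (by norm_num)).differentiableAt (by simp)
  have hs := h.isSymmSndFDerivAt (by simp) (1, 0) (0, 1)
  unfold dOne dTwo
  rw [fderiv_clm_apply hd (by fun_prop), fderiv_clm_apply hd (by fun_prop)]
  simpa using hs

theorem dOne_mul {f g : ℝ × ℝ → ℝ} {y : ℝ × ℝ} (hf : ContDiffAt ℝ 1 f y)
    (hg : ContDiffAt ℝ 1 g y) :
    dOne (fun y => f y * g y) y = dOne f y * g y + f y * dOne g y := by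
  unfold dOne
  rw [fderiv_fun_mul (hf.differentiableAt (by simp)) (hg.differentiableAt (by simp))]
  simp only [add_apply, smul_apply, smul_eq_mul]
  ring

theorem dTwo_mul {f g : ℝ × ℝ → ℝ} {y : ℝ × ℝ} (hf : ContDiffAt ℝ 1 f y)
    (hg : ContDiffAt ℝ 1 g y) :
    dTwo (fun y => f y * g y) y = dTwo f y * g y + f y * dTwo g y := by
  unfold dTwo
  rw [fderiv_fun_mul (hf.differentiableAt (by simp)) (hg.differentiableAt (by simp))]
  simp only [add_apply, smul_apply, smul_eq_mul]
  ring

theorem dOne_add {f g : ℝ × ℝ → ℝ} {y : ℝ × ℝ} (hf : ContDiffAt ℝ 1 f y)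
    (hg : ContDiffAt ℝ 1 g y) : dOne (fun y => f y + g y) y = dOne f y + dOne g y := by
  unfold dOne
  rw [fderiv_fun_add (hf.differentiableAt (by simp)) (hg.differentiableAt (by simp)), add_apply]

theorem dTwo_add {f g : ℝ × ℝ → ℝ} {y : ℝ × ℝ} (hf : ContDiffAt ℝ 1 f y)
    (hg : ContDiffAt ℝ 1 g y) : dTwo (fun y => f y + g y) y = dTwo f y + dTwo g y := by
  unfold dTwo
  rw [fderiv_fun_add (hf.differentiableAt (by simp)) (hg.differentiableAt (by simp)), add_apply]

theorem dOne_sub {f g : ℝ × ℝ → ℝ} {y : ℝ × ℝ} (hf : ContDiffAt ℝ 1 f y)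
    (hg : ContDiffAt ℝ 1 g y) : dOne (fun y => f y - g y) y = dOne f y - dOne g y := by
  unfold dOne
  rw [fderiv_fun_sub (hf.differentiableAt (by simp)) (hg.differentiableAt (by simp)), sub_apply]

theorem dTwo_sub {f g : ℝ × ℝ → ℝ} {y : ℝ × ℝ} (hf : ContDiffAt ℝ 1 f y)
    (hg : ContDiffAt ℝ 1 g y) : dTwo (fun y => f y - g y) y = dTwo f y - dTwo g y := by
  unfold dTwo
  rw [fderiv_fun_sub (hf.differentiableAt (by simp)) (hg.differentiableAt (by simp)), sub_apply]

theorem dOne_const_mul {f : ℝ × ℝ → ℝ} {y : ℝ × ℝ} (k : ℝ) (hf : ContDiffAt ℝ 1 f y) :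
    dOne (fun y => k * f y) y = k * dOne f y := by
  unfold dOne
  rw [fderiv_const_mul (hf.differentiableAt (by simp))]
  simp

theorem dTwo_const_mul {f : ℝ × ℝ → ℝ} {y : ℝ × ℝ} (k : ℝ) (hf : ContDiffAt ℝ 1 f y) :
    dTwo (fun y => k * f y) y = k * dTwo f y := by
  unfold dTwo
  rw [fderiv_const_mul (hf.differentiableAt (by simp))]
  simp

theorem dOne_const_mul_snd_add {w : ℝ × ℝ → ℝ} {y : ℝ × ℝ} (c : ℝ)
    (h : DifferentiableAt ℝ w y) : dOne (fun y => c * y.2 + w y) y = dOne w y := by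
  have : HasFDerivAt (fun y : ℝ × ℝ => c * y.2 + w y)
    (c • ContinuousLinearMap.snd ℝ ℝ ℝ + fderiv ℝ w y) y :=
    (hasFDerivAt_snd.const_mul c).add h.hasFDerivAt
  simp [dOne, this.fderiv]

theorem dTwo_const_mul_fst_add {w : ℝ × ℝ → ℝ} {y : ℝ × ℝ} (c : ℝ)
    (h : DifferentiableAt ℝ w y) : dTwo (fun y => c * y.1 + w y) y = dTwo w y := by
  have : HasFDerivAt (fun y : ℝ × ℝ => c * y.1 + w y)
    (c • ContinuousLinearMap.fst ℝ ℝ ℝ + fderiv ℝ w y) y :=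
    (hasFDerivAt_fst.const_mul c).add h.hasFDerivAt
  simp [dTwo, this.fderiv]

/-- A weakly divergence free `C¹` field is divergence free. -/
theorem div_eq_zero_of_weak {V₁ V₂ : ℝ × ℝ → ℝ}
    (hV₁ : ∀ y ∈ openHalfPlane, ContDiffAt ℝ 1 V₁ y)
    (hV₂ : ∀ y ∈ openHalfPlane, ContDiffAt ℝ 1 V₂ y)
    (h : ∀ ψ, IsTest openHalfPlane ψ → (∫ y, V₁ y * dOne ψ y) + ∫ y, V₂ y * dTwo ψ y = 0) :
    ∀ y ∈ openHalfPlane, dOne V₁ y + dTwo V₂ y = 0 := by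
  refine eqOn_zero_of_integral_test isOpen_openHalfPlane
    ((continuousOn_fderiv_apply hV₁ _).add (continuousOn_fderiv_apply hV₂ _)) fun ψ hψ => ?_
  have h₁ := fun y hy => hV₁ y (hψ.subset hy)
  have h₂ := fun y hy => hV₂ y (hψ.subset hy)
  have i₁ := integral_mul_fderiv_test hψ h₁ (1, 0)
  have i₂ := integral_mul_fderiv_test hψ h₂ (0, 1)
  have e := integral_add
    (integrable_mul_test hψ.compact (continuousOn_fderiv_apply h₁ (1, 0)) hψ.continuous le_rfl)
    (integrable_mul_test hψ.compact (continuousOn_fderiv_apply h₂ (0, 1)) hψ.continuous le_rfl)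
  have := h ψ hψ
  simp only [add_mul]
  unfold dOne dTwo at *
  rw [e]
  linarith

/-- The vorticity equation for the profile, from the weak form of its momentum equation. -/
theorem vorticity_of_weak {V₁ V₂ : ℝ × ℝ → ℝ} {κ c : ℝ}
    (hV₁ : ∀ y ∈ openHalfPlane, ContDiffAt ℝ 2 V₁ y)
    (hV₂ : ∀ y ∈ openHalfPlane, ContDiffAt ℝ 2 V₂ y)
    (hdiv : ∀ y ∈ openHalfPlane, dOne V₁ y + dTwo V₂ y = 0)
    (h : ∀ ψ, IsTest openHalfPlane ψ →
      (∫ y, (κ * V₁ y + (c * y.1 + V₁ y) * dOne V₁ y + (c * y.2 + V₂ y) * dTwo V₁ y) * dTwo ψ y)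
      - ∫ y, (κ * V₂ y + (c * y.1 + V₁ y) * dOne V₂ y + (c * y.2 + V₂ y) * dTwo V₂ y) * dOne ψ y
      = 0) :
    ∀ y ∈ openHalfPlane, (κ + c) * (dOne V₂ y - dTwo V₁ y)
      + (c * y.1 + V₁ y) * dOne (fun y => dOne V₂ y - dTwo V₁ y) y
      + (c * y.2 + V₂ y) * dTwo (fun y => dOne V₂ y - dTwo V₁ y) y = 0 := by
  set N₁ := fun y : ℝ × ℝ =>
    κ * V₁ y + (c * y.1 + V₁ y) * dOne V₁ y + (c * y.2 + V₂ y) * dTwo V₁ y with hN₁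
  set N₂ := fun y : ℝ × ℝ =>
    κ * V₂ y + (c * y.1 + V₁ y) * dOne V₂ y + (c * y.2 + V₂ y) * dTwo V₂ y with hN₂
  have c₁ := fun y hy => (hV₁ y hy).of_le (show (1 : WithTop ℕ∞) ≤ 2 by norm_num)
  have c₂ := fun y hy => (hV₂ y hy).of_le (show (1 : WithTop ℕ∞) ≤ 2 by norm_num)
  have b₁ : ∀ y ∈ openHalfPlane, ContDiffAt ℝ 1 (fun y : ℝ × ℝ => c * y.1 + V₁ y) y :=
    fun y hy => (contDiffAt_fst.const_smul c).add (c₁ y hy)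
  have b₂ : ∀ y ∈ openHalfPlane, ContDiffAt ℝ 1 (fun y : ℝ × ℝ => c * y.2 + V₂ y) y :=
    fun y hy => (contDiffAt_snd.const_smul c).add (c₂ y hy)
  have d₁ : ∀ y ∈ openHalfPlane, ContDiffAt ℝ 1 (dOne V₁) y :=
    fun y hy => contDiffAt_fderiv_apply (hV₁ y hy) _
  have d₂ : ∀ y ∈ openHalfPlane, ContDiffAt ℝ 1 (dTwo V₁) y :=
    fun y hy => contDiffAt_fderiv_apply (hV₁ y hy) _
  have d₃ : ∀ y ∈ openHalfPlane, ContDiffAt ℝ 1 (dOne V₂) y :=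
    fun y hy => contDiffAt_fderiv_apply (hV₂ y hy) _
  have d₄ : ∀ y ∈ openHalfPlane, ContDiffAt ℝ 1 (dTwo V₂) y :=
    fun y hy => contDiffAt_fderiv_apply (hV₂ y hy) _
  have m₁ : ∀ y ∈ openHalfPlane, ContDiffAt ℝ 1 (fun y => κ * V₁ y) y :=
    fun y hy => (c₁ y hy).const_smul κ
  have m₂ : ∀ y ∈ openHalfPlane, ContDiffAt ℝ 1 (fun y => κ * V₂ y) y :=
    fun y hy => (c₂ y hy).const_smul κ
  have a₁ : ∀ y ∈ openHalfPlane, ContDiffAt ℝ 1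
      (fun y : ℝ × ℝ => κ * V₁ y + (c * y.1 + V₁ y) * dOne V₁ y) y :=
    fun y hy => (m₁ y hy).add ((b₁ y hy).mul (d₁ y hy))
  have a₂ : ∀ y ∈ openHalfPlane, ContDiffAt ℝ 1
      (fun y : ℝ × ℝ => κ * V₂ y + (c * y.1 + V₁ y) * dOne V₂ y) y :=
    fun y hy => (m₂ y hy).add ((b₁ y hy).mul (d₃ y hy))
  have n₁ : ∀ y ∈ openHalfPlane, ContDiffAt ℝ 1 N₁ y :=
    fun y hy => (a₁ y hy).add ((b₂ y hy).mul (d₂ y hy))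
  have n₂ : ∀ y ∈ openHalfPlane, ContDiffAt ℝ 1 N₂ y :=
    fun y hy => (a₂ y hy).add ((b₂ y hy).mul (d₄ y hy))
  -- N is C¹ because V is C², so orthogonality of N to all fields (∂₂ψ, -∂₁ψ) means that its curl
  -- vanishes pointwise.
  have key : ∀ y ∈ openHalfPlane, dOne N₂ y - dTwo N₁ y = 0 := by
    refine eqOn_zero_of_integral_test isOpen_openHalfPlane
      ((continuousOn_fderiv_apply n₂ _).sub (continuousOn_fderiv_apply n₁ _)) fun ψ hψ => ?_
    have h₁ := fun y hy => n₁ y (hψ.subset hy)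
    have h₂ := fun y hy => n₂ y (hψ.subset hy)
    have i₁ := integral_mul_fderiv_test hψ h₁ (0, 1)
    have i₂ := integral_mul_fderiv_test hψ h₂ (1, 0)
    have e := integral_sub
      (integrable_mul_test hψ.compact (continuousOn_fderiv_apply h₂ (1, 0)) hψ.continuous le_rfl)
      (integrable_mul_test hψ.compact (continuousOn_fderiv_apply h₁ (0, 1)) hψ.continuous le_rfl)
    have h0 := h ψ hψ
    change (∫ y, N₁ y * fderiv ℝ ψ y (0, 1)) - ∫ y, N₂ y * fderiv ℝ ψ y (1, 0) = 0 at h0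
    simp only [sub_mul]
    change ∫ y, (fderiv ℝ N₂ y (1, 0) * ψ y - fderiv ℝ N₁ y (0, 1) * ψ y) = 0
    rw [e]
    linarith
  intro y hy
  have k := key y hy
  have x₁ := hdiv y hy
  rw [hN₁, hN₂] at k
  rw [dOne_add (a₂ y hy) ((b₂ y hy).mul (d₄ y hy)), dTwo_add (a₁ y hy) ((b₂ y hy).mul (d₂ y hy)),
    dOne_add (m₂ y hy) ((b₁ y hy).mul (d₃ y hy)),
    dTwo_add (m₁ y hy) ((b₁ y hy).mul (d₁ y hy)),
    dOne_mul (b₁ y hy) (d₃ y hy), dOne_mul (b₂ y hy) (d₄ y hy), dTwo_mul (b₁ y hy) (d₁ y hy),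
    dTwo_mul (b₂ y hy) (d₂ y hy), dOne_dTwo_comm (hV₂ y hy), ← dOne_dTwo_comm (hV₁ y hy)] at k
  rw [dOne_const_mul κ (c₂ y hy), dTwo_const_mul κ (c₁ y hy),
    dOne_const_mul_fst_add c ((c₁ y hy).differentiableAt (by simp)),
    dTwo_const_mul_snd_add c ((c₂ y hy).differentiableAt (by simp)),
    dTwo_const_mul_fst_add c ((c₁ y hy).differentiableAt (by simp)),
    dOne_const_mul_snd_add c ((c₂ y hy).differentiableAt (by simp))] at k
  rw [dOne_sub (d₃ y hy) (d₂ y hy), dTwo_sub (d₃ y hy) (d₂ y hy)]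
  -- curl N = (κ + c) ω + (c y + V) · ∇ω + ω div V; the last term drops. In the plane there is no
  -- other stretching term.
  linear_combination k - (dOne V₂ y - dTwo V₁ y) * x₁

/-! ### The half plane, and a maximum principle for stationary transport -/

theorem convex_halfPlane : Convex ℝ halfPlane :=
  convex_halfSpace_le (f := fun y : ℝ × ℝ => y.1) (LinearMap.isLinear (LinearMap.fst ℝ ℝ ℝ)) 0

theorem isClosed_halfPlane : IsClosed halfPlane := isClosed_le continuous_fst continuous_const

theorem openHalfPlane_subset : openHalfPlane ⊆ halfPlane := fun _ hy => le_of_lt (α := ℝ) hy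

theorem halfPlane_mem_nhds {y : ℝ × ℝ} (hy : y ∈ openHalfPlane) : halfPlane ∈ 𝓝 y :=
  mem_of_superset (isOpen_openHalfPlane.mem_nhds hy) openHalfPlane_subset

theorem uniqueDiffOn_halfPlane : UniqueDiffOn ℝ halfPlane :=
  uniqueDiffOn_convex convex_halfPlane
    ⟨(-1, 0), mem_interior_iff_mem_nhds.2 (halfPlane_mem_nhds (by simp [openHalfPlane]))⟩

theorem closure_openHalfPlane : halfPlane ⊆ closure openHalfPlane := by
  rintro ⟨y₁, y₂⟩ hy
  have hy' : y₁ ≤ 0 := hy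
  refine mem_closure_of_tendsto (f := fun s : ℝ => (y₁ - s, y₂)) (b := 𝓝[>] (0 : ℝ)) ?_ ?_
  · have : Tendsto (fun s : ℝ => (y₁ - s, y₂)) (𝓝 0) (𝓝 (y₁ - 0, y₂)) :=
      (show Continuous (fun s : ℝ => (y₁ - s, y₂)) by fun_prop).tendsto 0
    rw [sub_zero] at this
    exact this.mono_left nhdsWithin_le_nhds
  · filter_upwards [self_mem_nhdsWithin] with s hs
    have : (0 : ℝ) < s := hs
    exact (by linarith : y₁ - s < 0)

/-- Equalities between continuous functions extend from the open to the closed half plane. -/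
theorem eq_zero_of_openHalfPlane {f : ℝ × ℝ → ℝ} (hf : ContinuousOn f halfPlane)
    (h : ∀ y ∈ openHalfPlane, f y = 0) : ∀ y ∈ halfPlane, f y = 0 :=
  EqOn.of_subset_closure (g := fun _ => (0 : ℝ)) h hf continuousOn_const openHalfPlane_subset
    closure_openHalfPlane

/-- A bounded solution of `f + b · ∇f = 0` vanishes if `b` is tangent to the boundary and
`b · y` is bounded below. -/
theorem eq_zero_of_transport {f b₁ b₂ : ℝ × ℝ → ℝ} {M C : ℝ} (hf : ContDiffOn ℝ 1 f halfPlane)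
    (hM : ∀ y ∈ halfPlane, |f y| ≤ M) (hb : ∀ y : ℝ × ℝ, y.1 = 0 → b₁ y = 0)
    (hC : ∀ y ∈ halfPlane, -C ≤ y.1 * b₁ y + y.2 * b₂ y)
    (h : ∀ y ∈ halfPlane, f y + fderivWithin ℝ f halfPlane y (b₁ y, b₂ y) = 0) :
    ∀ y ∈ halfPlane, f y = 0 := by
  intro y₀ hy₀
  by_contra hne
  -- The weight q = 1 + ε|y|² forces f²/q to attain a maximum. Small ε keeps q + ε b · y positive,
  -- because q ≥ 1 and b · y ≥ -C.
  obtain ⟨ε, hε, hεC⟩ : ∃ ε > 0, ε * C < 1 := by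
    refine ⟨1 / (|C| + 1), by positivity, ?_⟩
    rw [div_mul_eq_mul_div, div_lt_one (by positivity)]
    linarith [le_abs_self C]
  set q : ℝ × ℝ → ℝ := fun y => 1 + ε * (y.1 ^ 2 + y.2 ^ 2) with hq
  have hq0 : ∀ y, 0 < q y := fun y => by positivity
  have hc : ContinuousOn (fun y => f y ^ 2 / q y) halfPlane :=
    (hf.continuousOn.pow 2).div (by fun_prop) fun y _ => (hq0 y).ne'
  have hpos : 0 < f y₀ ^ 2 / q y₀ := div_pos (by positivity) (hq0 _)
  have hfar : ∀ᶠ y in cocompact (ℝ × ℝ) ⊓ 𝓟 halfPlane, f y ^ 2 / q y ≤ f y₀ ^ 2 / q y₀ := by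
    rw [eventually_inf_principal]
    have hn : Tendsto (fun y : ℝ × ℝ => ‖y‖) (cocompact (ℝ × ℝ)) atTop := tendsto_norm_cocompact_atTop
    have h2 : Tendsto (fun y : ℝ × ℝ => ε * ‖y‖ ^ 2) (cocompact (ℝ × ℝ)) atTop :=
      ((tendsto_pow_atTop two_ne_zero).comp hn).const_mul_atTop hε
    filter_upwards [h2.eventually_ge_atTop (M ^ 2 / (f y₀ ^ 2 / q y₀))] with y hy hyH
    rw [div_le_iff₀ (hq0 y)]
    rw [div_le_iff₀ hpos] at hy
    have hny : ‖y‖ ^ 2 ≤ y.1 ^ 2 + y.2 ^ 2 := by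
      rw [Prod.norm_def, Real.norm_eq_abs, Real.norm_eq_abs]
      rcases max_choice |y.1| |y.2| with h | h <;> rw [h, sq_abs] <;> nlinarith [sq_nonneg y.1,
        sq_nonneg y.2]
    have hfM : f y ^ 2 ≤ M ^ 2 := by
      rw [← sq_abs (f y)]
      exact pow_le_pow_left₀ (abs_nonneg _) (hM y hyH) 2
    calc f y ^ 2 ≤ ε * ‖y‖ ^ 2 * (f y₀ ^ 2 / q y₀) := hfM.trans hy
      _ ≤ q y * (f y₀ ^ 2 / q y₀) := by
          refine mul_le_mul_of_nonneg_right ?_ hpos.le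
          have := mul_le_mul_of_nonneg_left hny hε.le
          simp only [hq]; linarith
      _ = _ := mul_comm _ _
  obtain ⟨y, hy, hmax⟩ := hc.exists_isMaxOn' isClosed_halfPlane hy₀ hfar
  have hfy : f y ≠ 0 := by
    intro h0
    have := hmax hy₀
    simp only [mem_ofPred_eq, h0] at this
    have hz : (0 : ℝ) ^ 2 / q y = 0 := by simp
    rw [hz] at this
    linarith
  set b : ℝ × ℝ := (b₁ y, b₂ y) with hbdef
  have hline : HasDerivAt (fun s : ℝ => y + s • b) b 0 := by
    simpa using ((hasDerivAt_id (0 : ℝ)).smul_const b).const_add y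
  -- If the maximum lies on the boundary, b is tangent there and the whole line stays in the
  -- boundary. So s = 0 is a two-sided local maximum in either case.
  have hnear : ∀ᶠ s : ℝ in 𝓝 0, y + s • b ∈ halfPlane := by
    rcases (show y.1 ≤ 0 from hy).eq_or_lt with h0 | h0
    · refine Eventually.of_forall fun s => ?_
      simp [halfPlane, hbdef, hb y h0, h0]
    · have := hline.continuousAt
      refine this (halfPlane_mem_nhds ?_)
      simpa [openHalfPlane] using h0
  have hfd : HasDerivAt (fun s : ℝ => f (y + s • b)) (-f y) 0 := by
    have h1 : HasFDerivWithinAt f (fderivWithin ℝ f halfPlane y) halfPlane (y + (0 : ℝ) • b) := by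
      simpa using ((hf.differentiableOn (by simp)) y hy).hasFDerivWithinAt
    have h2 := h1.comp_hasDerivWithinAt (f := fun s : ℝ => y + s • b)
      (s := {s : ℝ | y + s • b ∈ halfPlane}) 0 hline.hasDerivWithinAt fun s hs => hs
    rw [show -f y = fderivWithin ℝ f halfPlane y b by linarith [h y hy]]
    exact h2.hasDerivAt hnear
  have hqd : HasDerivAt (fun s : ℝ => q (y + s • b)) (ε * (2 * (y.1 * b₁ y + y.2 * b₂ y))) 0 := by
    have e1 : HasDerivAt (fun s : ℝ => y.1 + s * b₁ y) (b₁ y) 0 := by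
      simpa using ((hasDerivAt_id (0 : ℝ)).mul_const (b₁ y)).const_add y.1
    have e2 : HasDerivAt (fun s : ℝ => y.2 + s * b₂ y) (b₂ y) 0 := by
      simpa using ((hasDerivAt_id (0 : ℝ)).mul_const (b₂ y)).const_add y.2
    have e3 := (((e1.pow 2).add (e2.pow 2)).const_mul ε).const_add 1
    refine (e3.congr_deriv ?_)
    simp only [Nat.cast_ofNat, zero_mul, add_zero]; ring
  have hkd := (hfd.pow 2).div hqd (hq0 _).ne'
  have hloc : IsLocalMax (fun s : ℝ => f (y + s • b) ^ 2 / q (y + s • b)) 0 := by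
    filter_upwards [hnear] with s hs
    simpa using hmax hs
  have hz := hloc.hasDerivAt_eq_zero hkd
  rw [div_eq_zero_iff] at hz
  rcases hz with hz | hz
  · simp only [zero_smul, add_zero, Pi.pow_apply] at hz
    -- The derivative of f²/q along b vanishes, and b · ∇f = -f turns the numerator into -2 f² (q +
    -- ε b · y).
    have h1 : f y ^ 2 * (q y + ε * (y.1 * b₁ y + y.2 * b₂ y)) = 0 := by
      norm_num at hz
      linear_combination (-1 / 2) * hz
    have h2 : 0 < q y + ε * (y.1 * b₁ y + y.2 * b₂ y) := by
      have := mul_le_mul_of_nonneg_left (hC y hy) hε.le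
      have : 1 ≤ q y := by simp only [hq]; nlinarith [sq_nonneg y.1, sq_nonneg y.2]
      linarith
    exact (mul_pos (by positivity : 0 < f y ^ 2) h2).ne' h1
  · exact (pow_pos (hq0 _) 2).ne' hz

theorem IsSublinear.exists_bound {F : ℝ × ℝ → ℝ} (h : IsSublinear F) {ε : ℝ} (hε : 0 < ε) :
    ∃ R : ℝ, ∀ y ∈ halfPlane, R ≤ ‖y‖ → |F y| ≤ ε * ‖y‖ := by
  have := h.def hε
  rw [eventually_inf_principal, (hasBasis_cobounded_norm (E := ℝ × ℝ)).eventually_iff] at this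
  obtain ⟨R, -, hR⟩ := this
  exact ⟨R, fun y hy hRy => hR hRy hy⟩

/-! ### Divergence and curl free fields: Schwarz reflection and Liouville -/

/-- An entire function with `f(z) = o(|z|)` is constant. -/
theorem eq_of_differentiable_of_sublinear {f : ℂ → ℂ} (hf : Differentiable ℂ f)
    (h : ∀ ε > 0, ∃ R : ℝ, ∀ z, R ≤ ‖z‖ → ‖f z‖ ≤ ε * ‖z‖) (z w : ℂ) : f z = f w := by
  refine is_const_of_deriv_eq_zero hf (fun c => ?_) z w
  rw [← norm_le_zero_iff]
  refine le_of_forall_pos_le_add fun ε hε => ?_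
  obtain ⟨R, hR⟩ := h (ε / 2) (by positivity)
  -- On the circle of radius r about c one has R ≤ ‖z‖ ≤ 2r, so ‖f z‖ ≤ (ε/2)(2r), and Cauchy's
  -- estimate bounds the derivative by ε.
  set r := |R| + ‖c‖ + 1 with hr
  have hr0 : 0 < r := by positivity
  have := Complex.norm_deriv_le_of_forall_mem_sphere_norm_le (f := f) (c := c) (C := ε * r) hr0
    hf.diffContOnCl fun z hz => by
      have hz' : ‖z - c‖ = r := by simpa using hz
      have h1 : r - ‖c‖ ≤ ‖z‖ := by
        have := norm_sub_le z c; linarith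
      have h2 : ‖z‖ ≤ r + ‖c‖ := by
        have := norm_sub_norm_le z c; linarith
      have h3 := hR z (by linarith [le_abs_self R])
      nlinarith [abs_nonneg R, norm_nonneg c]
  rwa [mul_div_assoc, div_self hr0.ne', mul_one, ← zero_add ε] at this

/-- The complex function `V₁ - i V₂`, extended from the left half plane by Schwarz reflection. -/
noncomputable def reflect (V₁ V₂ : ℝ × ℝ → ℝ) (z : ℂ) : ℂ :=
  if z.re ≤ 0 then ⟨V₁ (z.re, z.im), -V₂ (z.re, z.im)⟩ else ⟨-V₁ (-z.re, z.im), -V₂ (-z.re, z.im)⟩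

/-- The Cauchy–Riemann criterion relative to a set: the real differential is multiplication by a.
Working within a set allows closed half planes, boundary included. -/
theorem hasFDerivWithinAt_complex_mk {f g : ℂ → ℝ} {f' g' : ℂ →L[ℝ] ℝ} {s : Set ℂ} {z : ℂ} {a : ℂ}
    (hf : HasFDerivWithinAt f f' s z) (hg : HasFDerivWithinAt g g' s z)
    (h1 : ∀ h : ℂ, f' h = (h * a).re) (h2 : ∀ h : ℂ, g' h = (h * a).im) :
    HasDerivWithinAt (fun z => (⟨f z, g z⟩ : ℂ)) a s z := by
  have e : HasFDerivWithinAt (fun z => (⟨f z, g z⟩ : ℂ))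
      (Complex.equivRealProdCLM.symm.toContinuousLinearMap.comp (f'.prod g')) s z :=
    (Complex.equivRealProdCLM.symm.toContinuousLinearMap.hasFDerivAt (x := (f z, g z))
      ).comp_hasFDerivWithinAt z (hf.prodMk hg)
  rw [hasDerivWithinAt_iff_hasFDerivWithinAt]
  refine e.of_restrictScalars ℝ ?_
  exact ContinuousLinearMap.ext fun h => Complex.ext (h1 h).symm (h2 h).symm

theorem clm_apply_eq (D : ℝ × ℝ →L[ℝ] ℝ) (a b : ℝ) : D (a, b) = a * D (1, 0) + b * D (0, 1) := by
  have : ((a, b) : ℝ × ℝ) = a • (1, 0) + b • (0, 1) := by simp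
  rw [this, map_add, map_smul, map_smul, smul_eq_mul, smul_eq_mul]

/-- A field on the half plane that is divergence and curl free, tangent to the boundary and
sublinear has vanishing first and constant second component. -/
theorem eq_of_div_curl_free {V₁ V₂ : ℝ × ℝ → ℝ} (h₁ : DifferentiableOn ℝ V₁ halfPlane)
    (h₂ : DifferentiableOn ℝ V₂ halfPlane) (s₁ : IsSublinear V₁) (s₂ : IsSublinear V₂)
    (hb : ∀ y : ℝ × ℝ, y.1 = 0 → V₁ y = 0)
    (hdiv : ∀ y ∈ halfPlane,
      fderivWithin ℝ V₁ halfPlane y (1, 0) + fderivWithin ℝ V₂ halfPlane y (0, 1) = 0)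
    (hcurl : ∀ y ∈ halfPlane,
      fderivWithin ℝ V₂ halfPlane y (1, 0) - fderivWithin ℝ V₁ halfPlane y (0, 1) = 0) :
    ∀ y ∈ halfPlane, V₁ y = 0 ∧ V₂ y = V₂ 0 := by
  set f := reflect V₁ V₂ with hfdef
  have hp : ∀ z : ℂ, HasFDerivAt (fun z : ℂ => (z.re, z.im))
      (Complex.reCLM.prod Complex.imCLM) z := fun z =>
    (Complex.reCLM.prod Complex.imCLM).hasFDerivAt
  have hp' : ∀ z : ℂ, HasFDerivAt (fun z : ℂ => (-z.re, z.im))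
      ((-Complex.reCLM).prod Complex.imCLM) z := fun z =>
    ((-Complex.reCLM).prod Complex.imCLM).hasFDerivAt
  have hleft : ∀ z : ℂ, z.re ≤ 0 → HasDerivWithinAt f
      ⟨fderivWithin ℝ V₁ halfPlane (z.re, z.im) (1, 0),
        -fderivWithin ℝ V₁ halfPlane (z.re, z.im) (0, 1)⟩ {z : ℂ | z.re ≤ 0} z := by
    intro z hz
    have hzH : (z.re, z.im) ∈ halfPlane := hz
    have e₁ := (h₁ _ hzH).hasFDerivWithinAt.comp (s := {z : ℂ | z.re ≤ 0}) z
      (hp z).hasFDerivWithinAt fun w hw => hw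
    have e₂ := (h₂ _ hzH).hasFDerivWithinAt.comp (s := {z : ℂ | z.re ≤ 0}) z
      (hp z).hasFDerivWithinAt fun w hw => hw
    refine (hasFDerivWithinAt_complex_mk e₁ e₂.neg (fun h => ?_) fun h => ?_).congr
      (fun w hw => ?_) ?_
    · simp [clm_apply_eq _ h.re h.im]
    · have := hdiv _ hzH
      have := hcurl _ hzH
      simp [clm_apply_eq _ h.re h.im]
      grind
    · exact if_pos hw
    · exact if_pos hz
  have hright : ∀ z : ℂ, 0 ≤ z.re → HasDerivWithinAt f
      ⟨fderivWithin ℝ V₁ halfPlane (-z.re, z.im) (1, 0),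
        fderivWithin ℝ V₁ halfPlane (-z.re, z.im) (0, 1)⟩ {z : ℂ | 0 ≤ z.re} z := by
    intro z hz
    have hzH : (-z.re, z.im) ∈ halfPlane := by simpa [halfPlane] using hz
    have hm : MapsTo (fun z : ℂ => (-z.re, z.im)) {z : ℂ | 0 ≤ z.re} halfPlane := fun w hw => by
      have : 0 ≤ w.re := hw
      simpa [halfPlane] using this
    have e₁ := (h₁ _ hzH).hasFDerivWithinAt.comp (s := {z : ℂ | 0 ≤ z.re}) z
      (hp' z).hasFDerivWithinAt hm
    have e₂ := (h₂ _ hzH).hasFDerivWithinAt.comp (s := {z : ℂ | 0 ≤ z.re}) z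
      (hp' z).hasFDerivWithinAt hm
    -- On the imaginary axis the two branches agree because V₁ vanishes there; hence the right
    -- formula holds on the closed right half plane.
    have hval : ∀ w : ℂ, 0 ≤ w.re → f w = ⟨-V₁ (-w.re, w.im), -V₂ (-w.re, w.im)⟩ := by
      intro w hw
      rcases hw.eq_or_lt with h | h
      · simp [hfdef, reflect, ← h, hb (0, w.im) rfl]
      · simp [hfdef, reflect, not_le.2 h]
    refine (hasFDerivWithinAt_complex_mk e₁.neg e₂.neg (fun h => ?_) fun h => ?_).congr
      (fun w hw => ?_) ?_
    · simp [clm_apply_eq _ (-h.re) h.im]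
      ring
    · have := hdiv _ hzH
      have := hcurl _ hzH
      simp [clm_apply_eq _ (-h.re) h.im]
      grind
    · exact hval w hw
    · exact hval z hz
  -- The one-sided complex derivatives on the axis differ only in the sign of ∂₂V₁. It is a
  -- tangential derivative of a function vanishing on the boundary, so they match and glue.
  have hbd : ∀ y : ℝ × ℝ, y.1 = 0 → fderivWithin ℝ V₁ halfPlane y (0, 1) = 0 := by
    intro y hy
    have hyH : y ∈ halfPlane := hy.le
    have hl : HasDerivAt (fun s : ℝ => ((0 : ℝ), s)) (0, 1) y.2 :=
      (hasDerivAt_const y.2 (0 : ℝ)).prodMk (hasDerivAt_id y.2)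
    have hy' : y = (0, y.2) := Prod.ext hy rfl
    have h3 := (h₁ y hyH).hasFDerivWithinAt
    rw [hy'] at h3
    have h4 := h3.comp_hasDerivAt y.2 hl (Eventually.of_forall fun s => le_refl (0 : ℝ))
    have h5 : (V₁ ∘ fun s : ℝ => ((0 : ℝ), s)) = fun _ => 0 := funext fun s => hb _ rfl
    rw [h5] at h4
    rw [hy']
    exact h4.unique (hasDerivAt_const _ _)
  have hdiff : Differentiable ℂ f := by
    intro z
    rcases lt_trichotomy z.re 0 with hz | hz | hz
    · exact ((hleft z hz.le).hasDerivAt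
        (mem_of_superset ((isOpen_lt Complex.continuous_re continuous_const).mem_nhds hz)
          fun w (hw : w.re < 0) => show w.re ≤ 0 from hw.le)).differentiableAt
    · have a := hleft z hz.le
      have b := hright z hz.ge
      rw [hz] at a b
      rw [hbd _ rfl, neg_zero] at a
      rw [neg_zero, hbd _ rfl] at b
      have := a.union b
      have hu : {z : ℂ | z.re ≤ 0} ∪ {z : ℂ | 0 ≤ z.re} = univ :=
        eq_univ_of_forall fun w => le_total w.re 0
      rw [hu, hasDerivWithinAt_univ] at this
      exact this.differentiableAt
    · exact ((hright z hz.le).hasDerivAt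
        (mem_of_superset ((isOpen_lt continuous_const Complex.continuous_re).mem_nhds hz)
          fun w (hw : 0 < w.re) => show 0 ≤ w.re from hw.le)).differentiableAt
  have hgrow : ∀ ε > 0, ∃ R : ℝ, ∀ z, R ≤ ‖z‖ → ‖f z‖ ≤ ε * ‖z‖ := by
    intro ε hε
    obtain ⟨R₁, hR₁⟩ := s₁.exists_bound (show 0 < ε / 2 by positivity)
    obtain ⟨R₂, hR₂⟩ := s₂.exists_bound (show 0 < ε / 2 by positivity)
    refine ⟨2 * max R₁ R₂, fun z hz => ?_⟩
    have main : ∀ a : ℝ, |a| = |z.re| → a ≤ 0 →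
        |V₁ (a, z.im)| + |V₂ (a, z.im)| ≤ ε * ‖z‖ := by
      intro a ha ha0
      have hn : ‖(a, z.im)‖ = max |z.re| |z.im| := by
        rw [Prod.norm_def, Real.norm_eq_abs, Real.norm_eq_abs, ha]
      have n1 : ‖(a, z.im)‖ ≤ ‖z‖ := by
        rw [hn]; exact max_le (Complex.abs_re_le_norm z) (Complex.abs_im_le_norm z)
      have n2 : ‖z‖ ≤ 2 * ‖(a, z.im)‖ := by
        rw [hn]
        have := Complex.norm_le_abs_re_add_abs_im z
        linarith [le_max_left |z.re| |z.im|, le_max_right |z.re| |z.im|]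
      have m1 := hR₁ (a, z.im) ha0 (by linarith [le_max_left R₁ R₂])
      have m2 := hR₂ (a, z.im) ha0 (by linarith [le_max_right R₁ R₂])
      nlinarith
    by_cases hz0 : z.re ≤ 0
    · have := main z.re rfl hz0
      refine (Complex.norm_le_abs_re_add_abs_im _).trans ?_
      simpa [hfdef, reflect, hz0] using this
    · have := main (-z.re) (abs_neg _) (by linarith)
      refine (Complex.norm_le_abs_re_add_abs_im _).trans ?_
      simpa [hfdef, reflect, hz0] using this
  intro y hy
  have := eq_of_differentiable_of_sublinear hdiff hgrow ⟨y.1, y.2⟩ 0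
  have hy' : y.1 ≤ 0 := hy
  have h00 : V₁ (0, 0) = 0 := hb _ rfl
  simp only [hfdef, reflect, hy', if_true, Complex.zero_re, Complex.zero_im, le_refl,
    Complex.ext_iff, h00, neg_inj] at this
  exact this

/-! ### Rigidity of the velocity and swirl profiles -/

/-- A profile solving the vorticity equation of the self-similar flow is trivial. -/
theorem velocity_profile_eq_zero {V₁ V₂ : ℝ × ℝ → ℝ} {c : ℝ} (hc : 0 < c)
    (h₁ : ContDiffOn ℝ 2 V₁ halfPlane) (h₂ : ContDiffOn ℝ 2 V₂ halfPlane)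
    (s₁ : IsSublinear V₁) (s₂ : IsSublinear V₂)
    (g₁ : HasBoundedGradient V₁) (g₂ : HasBoundedGradient V₂)
    (hb : ∀ y : ℝ × ℝ, y.1 = 0 → V₁ y = 0)
    (hodd : ∀ y ∈ halfPlane, V₂ (y.1, -y.2) = -V₂ y)
    (hdiv : ∀ y ∈ openHalfPlane, dOne V₁ y + dTwo V₂ y = 0)
    (hvort : ∀ y ∈ openHalfPlane, (dOne V₂ y - dTwo V₁ y)
      + (c * y.1 + V₁ y) * dOne (fun y => dOne V₂ y - dTwo V₁ y) y
      + (c * y.2 + V₂ y) * dTwo (fun y => dOne V₂ y - dTwo V₁ y) y = 0) :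
    ∀ y ∈ halfPlane, V₁ y = 0 ∧ V₂ y = 0 := by
  have hcd {V : ℝ × ℝ → ℝ} (h : ContDiffOn ℝ 2 V halfPlane) (e : ℝ × ℝ) :
      ContDiffOn ℝ 1 (fun y => fderivWithin ℝ V halfPlane y e) halfPlane :=
    (h.fderivWithin uniqueDiffOn_halfPlane (m := 1) (by norm_num)).clm_apply contDiffOn_const
  have heq (V : ℝ × ℝ → ℝ) {y : ℝ × ℝ} (hy : y ∈ openHalfPlane) :
      fderivWithin ℝ V halfPlane y = fderiv ℝ V y := fderivWithin_of_mem_nhds (halfPlane_mem_nhds hy)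
  set om : ℝ × ℝ → ℝ := fun y =>
    fderivWithin ℝ V₂ halfPlane y (1, 0) - fderivWithin ℝ V₁ halfPlane y (0, 1) with hom
  have hom1 : ContDiffOn ℝ 1 om halfPlane := (hcd h₂ _).sub (hcd h₁ _)
  have hdiv' := eq_zero_of_openHalfPlane
    (f := fun y => fderivWithin ℝ V₁ halfPlane y (1, 0) + fderivWithin ℝ V₂ halfPlane y (0, 1))
    ((hcd h₁ _).continuousOn.add (hcd h₂ _).continuousOn) fun y hy => by
      rw [heq V₁ hy, heq V₂ hy]; exact hdiv y hy
  obtain ⟨M₁, hM₁⟩ := g₁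
  obtain ⟨M₂, hM₂⟩ := g₂
  obtain ⟨R₁, hR₁⟩ := s₁.exists_bound (show 0 < c / 2 by positivity)
  obtain ⟨R₂, hR₂⟩ := s₂.exists_bound (show 0 < c / 2 by positivity)
  have hK : IsCompact (halfPlane ∩ Metric.closedBall (0 : ℝ × ℝ) (max R₁ R₂)) :=
    (isCompact_closedBall _ _).inter_left isClosed_halfPlane
  -- Lower bound for (c y + V) · y: by compactness on a ball, while outside it |Vᵢ| ≤ (c/2)‖y‖ makes
  -- the product nonnegative.
  obtain ⟨C, hC⟩ := hK.exists_bound_of_continuousOn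
    (f := fun y => y.1 * (c * y.1 + V₁ y) + y.2 * (c * y.2 + V₂ y)) (by
      have := h₁.continuousOn.mono (inter_subset_left (t := Metric.closedBall 0 (max R₁ R₂)))
      have := h₂.continuousOn.mono (inter_subset_left (t := Metric.closedBall 0 (max R₁ R₂)))
      fun_prop)
  have hz : ∀ y ∈ halfPlane, om y = 0 := by
    refine eq_zero_of_transport (M := M₂ + M₁) (C := |C|) (b₁ := fun y => c * y.1 + V₁ y)
      (b₂ := fun y => c * y.2 + V₂ y) hom1 (fun y hy => ?_) (fun y hy => by simp [hb y hy, hy])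
      (fun y hy => ?_) ?_
    · have n1 : ‖((0 : ℝ), (1 : ℝ))‖ = 1 := by simp [Prod.norm_def]
      have n2 : ‖((1 : ℝ), (0 : ℝ))‖ = 1 := by simp [Prod.norm_def]
      have a1 := (fderivWithin ℝ V₁ halfPlane y).le_opNorm (0, 1)
      have a2 := (fderivWithin ℝ V₂ halfPlane y).le_opNorm (1, 0)
      rw [n1, mul_one] at a1
      rw [n2, mul_one] at a2
      exact (abs_sub _ _).trans (add_le_add (a2.trans (hM₂ y hy)) (a1.trans (hM₁ y hy)))
    · by_cases hyR : ‖y‖ ≤ max R₁ R₂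
      · have := hC y ⟨hy, by simpa using hyR⟩
        rw [Real.norm_eq_abs] at this
        linarith [neg_abs_le (y.1 * (c * y.1 + V₁ y) + y.2 * (c * y.2 + V₂ y)), le_abs_self C]
      · push Not at hyR
        have m1 := hR₁ y hy (by linarith [le_max_left R₁ R₂])
        have m2 := hR₂ y hy (by linarith [le_max_right R₁ R₂])
        have k1 : |y.1| ≤ ‖y‖ := norm_fst_le y
        have k2 : |y.2| ≤ ‖y‖ := norm_snd_le y
        have p1 : |y.1 * V₁ y| ≤ |y.1| * (c / 2 * ‖y‖) := by
          rw [abs_mul]; exact mul_le_mul_of_nonneg_left m1 (abs_nonneg _)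
        have p2 : |y.2 * V₂ y| ≤ |y.2| * (c / 2 * ‖y‖) := by
          rw [abs_mul]; exact mul_le_mul_of_nonneg_left m2 (abs_nonneg _)
        have q1 := neg_abs_le (y.1 * V₁ y)
        have q2 := neg_abs_le (y.2 * V₂ y)
        -- The norm on ℝ × ℝ is the sup norm; the factor 2 here is what the choice c/2 above
        -- absorbs.
        have r : (|y.1| + |y.2|) * ‖y‖ ≤ 2 * (y.1 ^ 2 + y.2 ^ 2) := by
          rw [← sq_abs y.1, ← sq_abs y.2, Prod.norm_def, Real.norm_eq_abs, Real.norm_eq_abs]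
          rcases max_choice |y.1| |y.2| with h | h <;> rw [h] <;>
            nlinarith [sq_nonneg (|y.1| - |y.2|), sq_nonneg |y.1|, sq_nonneg |y.2|]
        have := mul_le_mul_of_nonneg_left r (show 0 ≤ c / 2 by positivity)
        have := abs_nonneg C
        nlinarith
    · refine eq_zero_of_openHalfPlane
        (f := fun y => om y + fderivWithin ℝ om halfPlane y (c * y.1 + V₁ y, c * y.2 + V₂ y))
        ?_ fun y hy => ?_
      · have d := (hom1.continuousOn_fderivWithin uniqueDiffOn_halfPlane (by simp))
        have v1 := h₁.continuousOn
        have v2 := h₂.continuousOn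
        exact hom1.continuousOn.add (d.clm_apply (by fun_prop))
      · have ev : om =ᶠ[𝓝 y] fun y => dOne V₂ y - dTwo V₁ y := by
          filter_upwards [isOpen_openHalfPlane.mem_nhds hy] with w hw
          simp only [hom, heq V₁ hw, heq V₂ hw, dOne, dTwo]
        have e2 := hvort y hy
        rw [heq om hy, ev.fderiv_eq, clm_apply_eq, ev.self_of_nhds]
        simp only [dOne, dTwo] at e2 ⊢
        linarith
  have hfin := eq_of_div_curl_free (h₁.differentiableOn (by simp)) (h₂.differentiableOn (by simp))
    s₁ s₂ hb hdiv' hz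
  -- The remaining freedom, a constant vertical flow, is excluded by oddness at the origin.
  have h0 : V₂ 0 = 0 := by
    have := hodd 0 (le_refl (0 : ℝ))
    have h' : (((0 : ℝ × ℝ).1, -(0 : ℝ × ℝ).2) : ℝ × ℝ) = 0 := by simp
    rw [h'] at this
    linarith
  exact fun y hy => ⟨(hfin y hy).1, (hfin y hy).2.trans h0⟩

/-- A `C¹` solution of `k F + c y · ∇F = 0` with `-1 < k / c` is constant, and zero if `k ≠ 0`. -/
theorem swirl_profile_eq_const {F : ℝ × ℝ → ℝ} {k c : ℝ} (hc : 0 < c) (hk : -c < k)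
    (hF : ContDiffOn ℝ 1 F halfPlane)
    (h : ∀ y ∈ openHalfPlane, k * F y + c * y.1 * dOne F y + c * y.2 * dTwo F y = 0) :
    ∀ y ∈ halfPlane, F y = F 0 ∧ (k ≠ 0 → F y = 0) := by
  have h0H : (0 : ℝ × ℝ) ∈ halfPlane := le_refl (0 : ℝ)
  -- Euler's relation along rays: F is homogeneous of degree -k/c, which the hypothesis `hk` makes
  -- less than 1.
  have hhom : ∀ y ∈ openHalfPlane, ∀ ρ > 0, ρ ^ (k / c) * F (ρ • y) = F y := by
    intro y hy
    have hd : ∀ ρ > 0, HasDerivAt (fun ρ : ℝ => ρ ^ (k / c) * F (ρ • y)) 0 ρ := by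
      intro ρ hρ
      have hρy : ρ • y ∈ openHalfPlane := mul_neg_of_pos_of_neg hρ hy
      have a := ((hF.differentiableOn (by simp)) _ (openHalfPlane_subset hρy)).differentiableAt
        (halfPlane_mem_nhds hρy)
      have l : HasDerivAt (fun ρ : ℝ => ρ • y) y ρ := by
        simpa using (hasDerivAt_id ρ).smul_const y
      have e := (Real.hasDerivAt_rpow_const (x := ρ) (p := k / c) (Or.inl hρ.ne')).mul
        (a.hasFDerivAt.comp_hasDerivAt ρ l)
      refine e.congr_deriv ?_
      have hh := h _ hρy
      rw [Real.rpow_sub_one hρ.ne']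
      simp only [dOne, dTwo, Prod.smul_fst, Prod.smul_snd, smul_eq_mul] at hh
      rw [show fderiv ℝ F (ρ • y) y = fderiv ℝ F (ρ • y) (y.1, y.2) from rfl, clm_apply_eq]
      simp only [Function.comp]
      field_simp
      linear_combination ρ ^ (k / c) * hh
    intro ρ hρ
    have hcst := (convex_Ioi (0 : ℝ)).is_const_of_fderivWithin_eq_zero (𝕜 := ℝ)
      (f := fun ρ : ℝ => ρ ^ (k / c) * F (ρ • y))
      (fun x hx => (hd x hx).differentiableAt.differentiableWithinAt)
      (fun x hx => by
        rw [fderivWithin_of_isOpen isOpen_Ioi hx, (hd x hx).hasFDerivAt.fderiv]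
        ext; simp) (mem_Ioi.2 hρ) (mem_Ioi.2 one_pos)
    simpa using hcst
  have hray : ∀ y ∈ openHalfPlane, Tendsto (fun ρ : ℝ => ρ • y) (𝓝[>] 0) (𝓝[halfPlane] 0) := by
    intro y hy
    refine tendsto_nhdsWithin_iff.2 ⟨?_, ?_⟩
    · have : Tendsto (fun ρ : ℝ => ρ • y) (𝓝 0) (𝓝 ((0 : ℝ) • y)) :=
        (show Continuous (fun ρ : ℝ => ρ • y) by fun_prop).tendsto 0
      rw [zero_smul] at this
      exact this.mono_left nhdsWithin_le_nhds
    · filter_upwards [self_mem_nhdsWithin] with ρ hρ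
      exact (mul_neg_of_pos_of_neg (mem_Ioi.1 hρ) hy).le
  have hlim : ∀ y ∈ openHalfPlane, Tendsto (fun ρ : ℝ => F (ρ • y)) (𝓝[>] 0) (𝓝 (F 0)) :=
    fun y hy => (hF.continuousOn 0 h0H).tendsto.comp (hray y hy)
  have hopen : ∀ y ∈ openHalfPlane, F y = F 0 ∧ (k ≠ 0 → F y = 0) := by
    intro y hy
    have hconst : ∀ᶠ ρ : ℝ in 𝓝[>] 0, ρ ^ (k / c) * F (ρ • y) = F y := by
      filter_upwards [self_mem_nhdsWithin] with ρ hρ using hhom y hy ρ hρ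
    have hpow : ∀ p : ℝ, 0 < p → Tendsto (fun ρ : ℝ => ρ ^ p) (𝓝[>] 0) (𝓝 0) := fun p hp => by
      have : Tendsto (fun ρ : ℝ => ρ ^ p) (𝓝 0) (𝓝 ((0 : ℝ) ^ p)) :=
        (Real.continuous_rpow_const hp.le).tendsto 0
      rw [Real.zero_rpow hp.ne'] at this
      exact this.mono_left nhdsWithin_le_nhds
    rcases lt_trichotomy k 0 with hk0 | hk0 | hk0
    · -- negative exponent: `F` vanishes at the origin and is differentiable there
      have hF0 : F 0 = 0 := by
        have h1 : Tendsto (fun ρ : ℝ => ρ ^ (-(k / c)) * F y) (𝓝[>] 0) (𝓝 (0 * F y)) :=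
          (hpow _ (neg_pos.2 (div_neg_of_neg_of_pos hk0 hc))).mul_const _
        rw [zero_mul] at h1
        refine tendsto_nhds_unique (hlim y hy) (h1.congr' ?_)
        filter_upwards [self_mem_nhdsWithin] with ρ hρ
        have hρ0 : 0 < ρ := hρ
        rw [← hhom y hy ρ hρ, ← mul_assoc, ← Real.rpow_add hρ0]
        simp
      have hFy : F y = 0 := by
        have hO : (fun x => F x - F 0) =O[𝓝[halfPlane] 0] fun x => x - 0 :=
          ((hF.differentiableOn (by simp)) 0 h0H).hasFDerivWithinAt.isBigO_sub
        have hO2 := hO.comp_tendsto (hray y hy)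
        obtain ⟨B, hB⟩ := hO2.bound
        -- Differentiability at 0 gives |F(ρy)| ≤ Bρ‖y‖, so |F(y)| ≤ B‖y‖ρ^(1 + k/c), and the
        -- exponent is positive.
        have h2 : Tendsto (fun ρ : ℝ => B * ‖y‖ * ρ ^ (1 + k / c)) (𝓝[>] 0) (𝓝 (B * ‖y‖ * 0)) := by
          refine (hpow _ ?_).const_mul _
          have : -1 < k / c := by rw [lt_div_iff₀ hc]; linarith
          linarith
        rw [mul_zero] at h2
        rw [← abs_nonpos_iff]
        refine ge_of_tendsto h2 ?_
        filter_upwards [hB, self_mem_nhdsWithin] with ρ h3 hρ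
        have hρ0 : 0 < ρ := hρ
        simp only [Function.comp, hF0, sub_zero, norm_smul, Real.norm_eq_abs,
          abs_of_pos hρ0] at h3
        rw [← hhom y hy ρ hρ, abs_mul, abs_of_pos (Real.rpow_pos_of_pos hρ0 _), Real.rpow_add hρ0,
          Real.rpow_one]
        have := mul_le_mul_of_nonneg_left h3 (Real.rpow_pos_of_pos hρ0 (k / c)).le
        linarith
      exact ⟨hFy.trans hF0.symm, fun _ => hFy⟩
    · subst hk0
      refine ⟨tendsto_nhds_unique (tendsto_const_nhds.congr' ?_) (hlim y hy), fun h => absurd rfl h⟩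
      filter_upwards [hconst] with ρ hρ
      simpa using hρ.symm
    · have hFy : F y = 0 := by
        have h1 := (hpow _ (div_pos hk0 hc)).mul (hlim y hy)
        rw [zero_mul] at h1
        exact tendsto_nhds_unique (tendsto_const_nhds.congr' (hconst.mono fun ρ h => h.symm)) h1
      have hF0 : F 0 = 0 := by
        refine tendsto_nhds_unique (hlim y hy) (tendsto_const_nhds.congr' ?_)
        filter_upwards [self_mem_nhdsWithin] with ρ hρ
        have := hhom y hy ρ hρ
        rw [hFy] at this
        exact ((mul_eq_zero.1 this).resolve_left (Real.rpow_pos_of_pos hρ _).ne').symm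
      exact ⟨hFy.trans hF0.symm, fun _ => hFy⟩
  refine fun y hy => ⟨?_, fun hk0 => ?_⟩
  · have := eq_zero_of_openHalfPlane (f := fun y => F y - F 0)
      (hF.continuousOn.sub continuousOn_const) (fun y hy => sub_eq_zero.2 (hopen y hy).1) y hy
    exact sub_eq_zero.1 this
  · exact eq_zero_of_openHalfPlane hF.continuousOn (fun y hy => (hopen y hy).2 hk0) y hy

/-! ### Rotational symmetry and the axisymmetric Euler equations on a slice -/

/-- Rotation about the vertical axis. -/
noncomputable def rot (φ : ℝ) : Space3 →L[ℝ] Space3 :=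
  LinearMap.toContinuousLinearMap
    { toFun := fun x =>
        !₂[Real.cos φ * x 0 - Real.sin φ * x 1, Real.sin φ * x 0 + Real.cos φ * x 1, x 2]
      map_add' := fun x y => by ext i; fin_cases i <;> simp <;> ring
      map_smul' := fun c x => by ext i; fin_cases i <;> simp <;> ring }

theorem rot_apply (φ : ℝ) (x : Space3) : rot φ x =
    !₂[Real.cos φ * x 0 - Real.sin φ * x 1, Real.sin φ * x 0 + Real.cos φ * x 1, x 2] := rfl

theorem rot_zero (x : Space3) : rot 0 x = x := by
  rw [rot_apply]; ext i; fin_cases i <;> simp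

theorem rot_two_pi (x : Space3) : rot (2 * Real.pi) x = x := by
  rw [rot_apply]; ext i; fin_cases i <;> simp

theorem radius_rot (φ : ℝ) (x : Space3) : radius (rot φ x) = radius x := by
  simp only [radius, rot_apply]
  congr 1
  simp
  linear_combination (x 0 ^ 2 + x 1 ^ 2) * Real.sin_sq_add_cos_sq φ

theorem inner_rot (φ : ℝ) (x y : Space3) : inner ℝ (rot φ x) (rot φ y) = inner ℝ x y := by
  simp only [rot_apply, PiLp.inner_apply, Fin.sum_univ_three]
  simp
  linear_combination (x 0 * y 0 + x 1 * y 1) * Real.sin_sq_add_cos_sq φ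

theorem hasDerivAt_rot (x : Space3) (φ : ℝ) :
    HasDerivAt (fun φ => rot φ x) (rot φ !₂[-x 1, x 0, 0]) φ := by
  have h : HasDerivAt (fun φ i => rot φ x i) (fun i => rot φ !₂[-x 1, x 0, 0] i) φ := by
    rw [hasDerivAt_pi]
    have hc := Real.hasDerivAt_cos φ
    have hs := Real.hasDerivAt_sin φ
    intro i
    fin_cases i
    · refine ((hc.mul_const (x 0)).sub (hs.mul_const (x 1))).congr_deriv ?_
      simp [rot_apply]; ring
    · refine ((hs.mul_const (x 0)).add (hc.mul_const (x 1))).congr_deriv ?_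
      simp [rot_apply]; ring
    · exact (hasDerivAt_const φ (x 2)).congr_deriv (by simp [rot_apply])
  exact ((EuclideanSpace.equiv (Fin 3) ℝ).symm.toContinuousLinearMap.hasFDerivAt).comp_hasDerivAt
    φ h

theorem rot_mem_cylinder {a b : ℝ} {x : Space3} (h : x ∈ cylinder a b) (φ : ℝ) :
    rot φ x ∈ cylinder a b := by
  refine ⟨(radius_rot φ x).trans_le h.1, ?_⟩
  simpa [rot_apply] using h.2

/-- Points strictly inside the cylinder. -/
def openCylinder (a b : ℝ) : Set Space3 := {x | radius x < 1 ∧ a < x 2 ∧ x 2 < b}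

theorem continuous_radius : Continuous radius := by
  unfold radius
  fun_prop

theorem isOpen_openCylinder (a b : ℝ) : IsOpen (openCylinder a b) :=
  (isOpen_lt continuous_radius continuous_const).inter
    ((isOpen_lt (f := fun _ => a) (g := fun x : Space3 => x 2) (by fun_prop) (by fun_prop)).inter
      (isOpen_lt (f := fun x : Space3 => x 2) (g := fun _ => b) (by fun_prop) (by fun_prop)))

theorem openCylinder_subset (a b : ℝ) : openCylinder a b ⊆ cylinder a b :=
  fun _ h => ⟨h.1.le, h.2.1.le, h.2.2.le⟩

theorem openCylinder_subset_interior (a b : ℝ) : openCylinder a b ⊆ interior (cylinder a b) :=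
  interior_maximal (openCylinder_subset a b) (isOpen_openCylinder a b)

theorem rot_mem_openCylinder {a b : ℝ} {x : Space3} (h : x ∈ openCylinder a b) (φ : ℝ) :
    rot φ x ∈ openCylinder a b := by
  refine ⟨(radius_rot φ x).trans_lt h.1, ?_⟩
  simpa [rot_apply] using h.2

variable {a b T₀ : ℝ} {v : ℝ → Space3 → Space3} {p : ℝ → Space3 → ℝ}

theorem cylinder_prod_mem_nhds {x : Space3} {t : ℝ} (hx : x ∈ openCylinder a b)
    (ht : t ∈ Ioo 0 T₀) : cylinder a b ×ˢ Ico 0 T₀ ∈ 𝓝 (x, t) :=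
  prod_mem_nhds (mem_of_superset ((isOpen_openCylinder a b).mem_nhds hx) (openCylinder_subset a b))
    (Ico_mem_nhds ht.1 ht.2)

namespace IsSmoothAxisymmetricEuler

theorem contDiffAt_velocity (h : IsSmoothAxisymmetricEuler a b T₀ v p) {x : Space3} {t : ℝ}
    (hx : x ∈ openCylinder a b) (ht : t ∈ Ioo 0 T₀) :
    ContDiffAt ℝ ∞ (fun q : Space3 × ℝ => v q.2 q.1) (x, t) :=
  h.smooth_velocity.contDiffAt (cylinder_prod_mem_nhds hx ht)

theorem contDiffAt_pressure (h : IsSmoothAxisymmetricEuler a b T₀ v p) {x : Space3} {t : ℝ}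
    (hx : x ∈ openCylinder a b) (ht : t ∈ Ioo 0 T₀) :
    ContDiffAt ℝ ∞ (fun q : Space3 × ℝ => p q.2 q.1) (x, t) :=
  h.smooth_pressure.contDiffAt (cylinder_prod_mem_nhds hx ht)

theorem hasFDerivAt_space {E : Type*} [NormedAddCommGroup E] [NormedSpace ℝ E]
    {g : ℝ → Space3 → E} {x : Space3} {t : ℝ}
    (h : DifferentiableAt ℝ (fun q : Space3 × ℝ => g q.2 q.1) (x, t)) :
    HasFDerivAt (g t) ((fderiv ℝ (fun q : Space3 × ℝ => g q.2 q.1) (x, t)).comp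
      (ContinuousLinearMap.inl ℝ Space3 ℝ)) x :=
  h.hasFDerivAt.comp (f := fun x => (x, t)) x (hasFDerivAt_prodMk_left x t)

theorem hasDerivAt_time {E : Type*} [NormedAddCommGroup E] [NormedSpace ℝ E]
    {g : ℝ → Space3 → E} {x : Space3} {t : ℝ}
    (h : DifferentiableAt ℝ (fun q : Space3 × ℝ => g q.2 q.1) (x, t)) :
    HasDerivAt (fun s => g s x) (fderiv ℝ (fun q : Space3 × ℝ => g q.2 q.1) (x, t) (0, 1)) t :=
  h.hasFDerivAt.comp_hasDerivAt t ((hasDerivAt_const t x).prodMk (hasDerivAt_id t))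

theorem equivariant (h : IsSmoothAxisymmetricEuler a b T₀ v p) {x : Space3} {t : ℝ}
    (hx : x ∈ cylinder a b) (ht : t ∈ Ico 0 T₀) (φ : ℝ) : v t (rot φ x) = rot φ (v t x) := by
  obtain ⟨vr, vth, vz, hv⟩ := h.axisymmetric
  rw [hv t ht _ (rot_mem_cylinder hx φ), hv t ht x hx, radius_rot]
  have h2 : rot φ x 2 = x 2 := by simp [rot_apply]
  rw [h2]
  simp only [eR, eTheta, eZ, radius_rot]
  simp only [rot_apply]
  ext i
  fin_cases i <;> simp <;> ring

/-- Axial symmetry is assumed for the velocity only. The momentum equation transfers it to the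
pressure gradient, every other term being equivariant under rotations. -/
theorem gradient_rot (h : IsSmoothAxisymmetricEuler a b T₀ v p) {x : Space3} {t : ℝ}
    (hx : x ∈ openCylinder a b) (ht : t ∈ Ioo 0 T₀) (φ : ℝ) :
    gradient (p t) (rot φ x) = rot φ (gradient (p t) x) := by
  have hx' := rot_mem_openCylinder hx φ
  have m := h.momentum t ht _ (openCylinder_subset_interior a b hx)
  have m' := h.momentum t ht _ (openCylinder_subset_interior a b hx')
  have d := (h.contDiffAt_velocity hx ht).differentiableAt (by simp)
  have d' := (h.contDiffAt_velocity hx' ht).differentiableAt (by simp)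
  have e₁ : deriv (fun s => v s (rot φ x)) t = rot φ (deriv (fun s => v s x) t) := by
    have k := (rot φ).hasFDerivAt.comp_hasDerivAt t (hasDerivAt_time d)
    rw [(hasDerivAt_time d).deriv, ← k.deriv]
    refine EventuallyEq.deriv_eq ?_
    filter_upwards [Ico_mem_nhds ht.1 ht.2] with s hs
    exact h.equivariant (openCylinder_subset a b hx) hs φ
  have e₂ : (fderiv ℝ (v t) (rot φ x)).comp (rot φ) = (rot φ).comp (fderiv ℝ (v t) x) := by
    have k₁ := (hasFDerivAt_space d').differentiableAt.hasFDerivAt.comp x (rot φ).hasFDerivAt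
    have k₂ := (rot φ).hasFDerivAt.comp x (hasFDerivAt_space d).differentiableAt.hasFDerivAt
    refine k₁.unique (k₂.congr_of_eventuallyEq ?_)
    filter_upwards [(isOpen_openCylinder a b).mem_nhds hx] with y hy
    exact h.equivariant (openCylinder_subset a b hy) ⟨ht.1.le, ht.2⟩ φ
  rw [h.equivariant (openCylinder_subset a b hx) ⟨ht.1.le, ht.2⟩, e₁] at m'
  have e₃ := DFunLike.congr_fun e₂ (v t x)
  simp only [ContinuousLinearMap.comp_apply] at e₃
  rw [e₃] at m'
  have := congrArg (rot φ) m
  rw [map_add, map_add, map_zero] at this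
  exact add_left_cancel (m'.trans this.symm)

end IsSmoothAxisymmetricEuler

/-- The point with cylindrical coordinates `(r, 0, z)`. -/
noncomputable def slicePoint (r z : ℝ) : Space3 := !₂[r, 0, z]

theorem radius_slicePoint {r : ℝ} (hr : 0 ≤ r) (z : ℝ) : radius (slicePoint r z) = r := by
  simp [radius, slicePoint, Real.sqrt_sq hr]

theorem slicePoint_mem_openCylinder {r z : ℝ} (hr : 0 ≤ r) (hr1 : r < 1) (hz : z ∈ Ioo a b) :
    slicePoint r z ∈ openCylinder a b := by
  refine ⟨(radius_slicePoint hr z).trans_lt hr1, ?_⟩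
  simpa [slicePoint] using hz

/-- The standard basis of `ℝ³`. -/
noncomputable def basisVec (i : Fin 3) : Space3 := EuclideanSpace.single i 1

namespace IsSmoothAxisymmetricEuler

/-- Differentiate v(R_φ x) = R_φ v(x) at φ = 0. This replaces the angular derivative by algebraic
terms, the source of all the 1/r terms. -/
theorem fderiv_angular (h : IsSmoothAxisymmetricEuler a b T₀ v p) {r z t : ℝ} (hr : 0 ≤ r)
    (hr1 : r < 1) (hz : z ∈ Ioo a b) (ht : t ∈ Ioo 0 T₀) :
    r • fderiv ℝ (v t) (slicePoint r z) (basisVec 1)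
      = !₂[-(v t (slicePoint r z) 1), v t (slicePoint r z) 0, 0] := by
  have hx := slicePoint_mem_openCylinder hr hr1 hz
  have d := (h.contDiffAt_velocity hx ht).differentiableAt (by simp)
  have k₁ := hasDerivAt_rot (slicePoint r z) 0
  have k₂ := hasDerivAt_rot (v t (slicePoint r z)) 0
  rw [rot_zero] at k₁ k₂
  have k₃ := (hasFDerivAt_space d).differentiableAt.hasFDerivAt
  nth_rewrite 2 [← rot_zero (slicePoint r z)] at k₃
  have k₄ := k₃.comp_hasDerivAt 0 k₁
  have k₅ : (v t ∘ fun φ => rot φ (slicePoint r z)) = fun φ => rot φ (v t (slicePoint r z)) :=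
    funext fun φ => h.equivariant (openCylinder_subset a b hx) ⟨ht.1.le, ht.2⟩ φ
  rw [k₅] at k₄
  rw [← k₄.unique k₂, ← map_smul]
  congr 1
  ext i; fin_cases i <;> simp [slicePoint, basisVec]

theorem gradient_angular (h : IsSmoothAxisymmetricEuler a b T₀ v p) {r z t : ℝ} (hr : 0 < r)
    (hr1 : r < 1) (hz : z ∈ Ioo a b) (ht : t ∈ Ioo 0 T₀) :
    gradient (p t) (slicePoint r z) 1 = 0 := by
  have hx := slicePoint_mem_openCylinder hr.le hr1 hz
  have key : ∀ φ, HasDerivAt (fun φ => p t (rot φ (slicePoint r z)))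
      (r * gradient (p t) (slicePoint r z) 1) φ := by
    intro φ
    have d := (hasFDerivAt_space ((h.contDiffAt_pressure (rot_mem_openCylinder hx φ)
      ht).differentiableAt (by simp))).differentiableAt
    have k := d.hasGradientAt.hasFDerivAt.comp_hasDerivAt φ (hasDerivAt_rot (slicePoint r z) φ)
    refine k.congr_deriv ?_
    rw [h.gradient_rot hx ht φ, InnerProductSpace.toDual_apply_apply, inner_rot,
      PiLp.inner_apply, Fin.sum_univ_three]
    simp [slicePoint]
  -- By equivariance of the gradient, the angular derivative of p is constant along the circle; p is
  -- single valued after a full turn, so Rolle makes that constant 0.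
  obtain ⟨φ, -, hφ⟩ := exists_hasDerivAt_eq_zero (f := fun φ => p t (rot φ (slicePoint r z)))
    Real.two_pi_pos (fun φ _ => (key φ).continuousAt.continuousWithinAt)
    (by simp only [rot_zero, rot_two_pi]) fun φ _ => key φ
  exact (mul_eq_zero.1 hφ).resolve_left hr.ne'

theorem eq_sum_basisVec (u : Space3) :
    u = u 0 • basisVec 0 + u 1 • basisVec 1 + u 2 • basisVec 2 := by
  ext i; fin_cases i <;> simp [basisVec]

theorem fderiv_component (h : IsSmoothAxisymmetricEuler a b T₀ v p) {x : Space3} {t : ℝ}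
    (hx : x ∈ openCylinder a b) (ht : t ∈ Ioo 0 T₀) (i : Fin 3) (ξ : Space3 × ℝ) :
    fderiv ℝ (fun q : Space3 × ℝ => v q.2 q.1 i) (x, t) ξ
      = fderiv ℝ (fun q : Space3 × ℝ => v q.2 q.1) (x, t) ξ i := by
  have d := ((h.contDiffAt_velocity hx ht).differentiableAt (by simp)).hasFDerivAt
  have := (EuclideanSpace.proj (𝕜 := ℝ) i).hasFDerivAt.comp (x, t) d
  exact DFunLike.congr_fun this.fderiv ξ

/-- The axisymmetric Euler equations in the half plane `θ = 0`. -/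
theorem slice_equations (h : IsSmoothAxisymmetricEuler a b T₀ v p) {r z t : ℝ} (hr : 0 < r)
    (hr1 : r < 1) (hz : z ∈ Ioo a b) (ht : t ∈ Ioo 0 T₀) {u : Space3}
    (hu : v t (slicePoint r z) = u) {D : Fin 3 → Space3 × ℝ →L[ℝ] ℝ}
    (hD : ∀ i, D i = fderiv ℝ (fun q : Space3 × ℝ => v q.2 q.1 i) (slicePoint r z, t))
    {B : Space3 × ℝ →L[ℝ] ℝ}
    (hB : B = fderiv ℝ (fun q : Space3 × ℝ => p q.2 q.1) (slicePoint r z, t)) :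
    (D 0 (0, 1) + u 0 * D 0 (basisVec 0, 0) + u 2 * D 0 (basisVec 2, 0) - u 1 ^ 2 / r
      + B (basisVec 0, 0) = 0) ∧
    (D 1 (0, 1) + u 0 * D 1 (basisVec 0, 0) + u 2 * D 1 (basisVec 2, 0) + u 0 * u 1 / r = 0) ∧
    (D 2 (0, 1) + u 0 * D 2 (basisVec 0, 0) + u 2 * D 2 (basisVec 2, 0)
      + B (basisVec 2, 0) = 0) ∧
    (D 0 (basisVec 0, 0) + D 2 (basisVec 2, 0) + u 0 / r = 0) := by
  have hx := slicePoint_mem_openCylinder hr.le hr1 hz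
  have hxi := openCylinder_subset_interior a b hx
  have d := (h.contDiffAt_velocity hx ht).differentiableAt (by simp)
  have dp := (h.contDiffAt_pressure hx ht).differentiableAt (by simp)
  have m := h.momentum t ht _ hxi
  have hdiv := h.incompressible t ht _ hxi
  have g0 := h.gradient_angular hr hr1 hz ht
  have ang := h.fderiv_angular hr.le hr1 hz ht
  have hE : ∀ (w : Space3) (i : Fin 3), fderiv ℝ (v t) (slicePoint r z) w i = D i (w, 0) := by
    intro w i
    rw [hD, h.fderiv_component hx ht, (hasFDerivAt_space d).fderiv]
    rfl
  have hg : ∀ i : Fin 3, gradient (p t) (slicePoint r z) i = B (basisVec i, 0) := by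
    intro i
    have k := (hasFDerivAt_space dp).differentiableAt.hasGradientAt.hasFDerivAt
    have k2 := DFunLike.congr_fun (k.unique (hasFDerivAt_space dp)) (basisVec i)
    rw [InnerProductSpace.toDual_apply_apply, basisVec, EuclideanSpace.inner_single_right] at k2
    rw [hB]
    simpa [basisVec] using k2
  have hT : ∀ i : Fin 3, deriv (fun s => v s (slicePoint r z)) t i = D i (0, 1) := by
    intro i
    rw [hD, h.fderiv_component hx ht, (hasDerivAt_time d).deriv]
  rw [hu] at m ang
  -- At θ = 0 the Cartesian components 0, 1, 2 are the radial, angular and vertical ones, so no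
  -- change of frame is needed beyond this substitution.
  have hang : ∀ i : Fin 3, D i (basisVec 1, 0) = (!₂[-(u 1), u 0, 0] : Space3) i / r := by
    intro i
    rw [← ang, eq_div_iff hr.ne', ← hE]
    simp [mul_comm]
  have hm : ∀ i : Fin 3, D i (0, 1) + (u 0 * D i (basisVec 0, 0) + u 1 * D i (basisVec 1, 0)
      + u 2 * D i (basisVec 2, 0)) + B (basisVec i, 0) = 0 := by
    intro i
    have k := congrArg (fun w : Space3 => w i) m
    simp only [PiLp.add_apply, PiLp.zero_apply] at k
    rw [hT, hg] at k
    rw [congrArg (fderiv ℝ (v t) (slicePoint r z)) (eq_sum_basisVec u)] at k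
    simp only [map_add, map_smul, PiLp.add_apply, PiLp.smul_apply, smul_eq_mul, hE] at k
    exact k
  rw [hg] at g0
  have hd : D 0 (basisVec 0, 0) + D 1 (basisVec 1, 0) + D 2 (basisVec 2, 0) = 0 := by
    rw [divergence, Fin.sum_univ_three] at hdiv
    rw [← hE, ← hE, ← hE]
    exact hdiv
  have m0 := hm 0
  have m1 := hm 1
  have m2 := hm 2
  rw [hang] at m0 m1 m2 hd
  simp only [Fin.isValue, Matrix.cons_val_zero, Matrix.cons_val_one,
    Matrix.cons_val] at m0 m1 m2 hd
  rw [g0] at m1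
  refine ⟨?_, ?_, ?_, ?_⟩
  · linear_combination m0
  · linear_combination m1
  · linear_combination m2
  · linear_combination hd

end IsSmoothAxisymmetricEuler

/-! ### Euler equations in self-similar variables -/

theorem slicePoint_eq (r z : ℝ) : slicePoint r z = r • basisVec 0 + z • basisVec 2 := by
  ext i; fin_cases i <;> simp [slicePoint, basisVec]

/-- The physical space-time point with rescaled coordinates `y` at time `T₀ - τ`. -/
noncomputable def scalePoint (c T₀ : ℝ) (q : ℝ × ℝ × ℝ) : Space3 × ℝ :=
  (slicePoint (1 + q.1 ^ c * q.2.1) (q.1 ^ c * q.2.2), T₀ - q.1)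

/-- A scalar field in rescaled variables. -/
noncomputable def scaled (κ c T₀ : ℝ) (G : Space3 × ℝ → ℝ) (q : ℝ × ℝ × ℝ) : ℝ :=
  q.1 ^ κ * G (scalePoint c T₀ q)

theorem contDiffAt_rpow_fst (κ : ℝ) {q : ℝ × ℝ × ℝ} (hq : 0 < q.1) :
    ContDiffAt ℝ ∞ (fun q : ℝ × ℝ × ℝ => q.1 ^ κ) q :=
  contDiffAt_fst.rpow_const_of_ne hq.ne'

theorem contDiffAt_scalePoint (c T₀ : ℝ) {q : ℝ × ℝ × ℝ} (hq : 0 < q.1) :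
    ContDiffAt ℝ ∞ (scalePoint c T₀) q := by
  unfold scalePoint
  simp only [slicePoint_eq]
  have := contDiffAt_rpow_fst c hq
  fun_prop

theorem contDiffAt_scaled (κ c T₀ : ℝ) {G : Space3 × ℝ → ℝ} {q : ℝ × ℝ × ℝ} (hq : 0 < q.1)
    (hG : ContDiffAt ℝ ∞ G (scalePoint c T₀ q)) : ContDiffAt ℝ ∞ (scaled κ c T₀ G) q :=
  (contDiffAt_rpow_fst κ hq).mul (hG.comp q (contDiffAt_scalePoint c T₀ hq))

theorem rpow_one_add_of_pos {τ : ℝ} (hτ : 0 < τ) (s : ℝ) : τ ^ (1 + s) = τ * τ ^ s := by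
  rw [Real.rpow_add hτ, Real.rpow_one]

section derivatives

variable {κ c τ : ℝ} {y : ℝ × ℝ} {G : Space3 × ℝ → ℝ}

theorem dOne_scaled (hτ : 0 < τ) (hG : ContDiffAt ℝ ∞ G (scalePoint c T₀ (τ, y))) :
    dOne (fun y => scaled κ c T₀ G (τ, y)) y
      = τ ^ κ * τ ^ c * fderiv ℝ G (scalePoint c T₀ (τ, y)) (basisVec 0, 0) := by
  have d := ((contDiffAt_slice (contDiffAt_scaled κ c T₀ (q := (τ, y)) hτ
    hG)).differentiableAt (by simp)).hasFDerivAt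
  have l : HasDerivAt (fun s : ℝ => (s, y.2)) ((1 : ℝ), (0 : ℝ)) y.1 :=
    (hasDerivAt_id _).prodMk (hasDerivAt_const _ _)
  have k := d.comp_hasDerivAt y.1 l
  have m : HasDerivAt (fun s : ℝ => scalePoint c T₀ (τ, s, y.2)) (τ ^ c • basisVec 0, 0) y.1 := by
    unfold scalePoint
    simp only [slicePoint_eq]
    refine HasDerivAt.prodMk ?_ (hasDerivAt_const _ _)
    have := ((((hasDerivAt_id y.1).const_mul (τ ^ c)).const_add 1).smul_const
      (basisVec 0)).add_const ((τ ^ c * y.2) • basisVec 2)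
    simpa using this
  have k' := ((hG.differentiableAt (by simp)).hasFDerivAt.comp_hasDerivAt y.1 m).const_mul (τ ^ κ)
  have := k.unique k'
  rw [dOne, this, show ((τ ^ c • basisVec 0, 0) : Space3 × ℝ) = τ ^ c • (basisVec 0, 0) by simp,
    map_smul, smul_eq_mul, mul_assoc]

theorem dTwo_scaled (hτ : 0 < τ) (hG : ContDiffAt ℝ ∞ G (scalePoint c T₀ (τ, y))) :
    dTwo (fun y => scaled κ c T₀ G (τ, y)) y
      = τ ^ κ * τ ^ c * fderiv ℝ G (scalePoint c T₀ (τ, y)) (basisVec 2, 0) := by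
  have d := ((contDiffAt_slice (contDiffAt_scaled κ c T₀ (q := (τ, y)) hτ
    hG)).differentiableAt (by simp)).hasFDerivAt
  have l : HasDerivAt (fun s : ℝ => (y.1, s)) ((0 : ℝ), (1 : ℝ)) y.2 :=
    (hasDerivAt_const _ _).prodMk (hasDerivAt_id _)
  have k := d.comp_hasDerivAt y.2 l
  have m : HasDerivAt (fun s : ℝ => scalePoint c T₀ (τ, y.1, s)) (τ ^ c • basisVec 2, 0) y.2 := by
    unfold scalePoint
    simp only [slicePoint_eq]
    refine HasDerivAt.prodMk ?_ (hasDerivAt_const _ _)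
    have := (((hasDerivAt_id y.2).const_mul (τ ^ c)).smul_const
      (basisVec 2)).const_add ((1 + τ ^ c * y.1) • basisVec 0)
    simpa using this
  have k' := ((hG.differentiableAt (by simp)).hasFDerivAt.comp_hasDerivAt y.2 m).const_mul (τ ^ κ)
  have := k.unique k'
  rw [dTwo, this, show ((τ ^ c • basisVec 2, 0) : Space3 × ℝ) = τ ^ c • (basisVec 2, 0) by simp,
    map_smul, smul_eq_mul, mul_assoc]

/-- Chain rule: the prefactor gives κ, the dilation gives c y · ∇, and t = T₀ - τ accounts for the
minus sign of the time derivative. -/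
theorem mul_deriv_scaled (hτ : 0 < τ) (hG : ContDiffAt ℝ ∞ G (scalePoint c T₀ (τ, y))) :
    τ * fderiv ℝ (scaled κ c T₀ G) (τ, y) (1, 0)
      = κ * scaled κ c T₀ G (τ, y) + c * y.1 * dOne (fun y => scaled κ c T₀ G (τ, y)) y
        + c * y.2 * dTwo (fun y => scaled κ c T₀ G (τ, y)) y
        - τ * τ ^ κ * fderiv ℝ G (scalePoint c T₀ (τ, y)) (0, 1) := by
  have d := ((contDiffAt_scaled κ c T₀ (q := (τ, y)) hτ hG).differentiableAt (by simp)).hasFDerivAt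
  have l : HasDerivAt (fun s : ℝ => (s, y)) ((1 : ℝ), (0 : ℝ × ℝ)) τ :=
    (hasDerivAt_id _).prodMk (hasDerivAt_const _ _)
  have k := d.comp_hasDerivAt τ l
  have hc : HasDerivAt (fun s : ℝ => s ^ c) (c * τ ^ (c - 1)) τ :=
    Real.hasDerivAt_rpow_const (Or.inl hτ.ne')
  have m : HasDerivAt (fun s : ℝ => scalePoint c T₀ (s, y))
      ((c * τ ^ (c - 1) * y.1) • basisVec 0 + (c * τ ^ (c - 1) * y.2) • basisVec 2, -1) τ := by
    unfold scalePoint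
    simp only [slicePoint_eq]
    refine HasDerivAt.prodMk ?_ ?_
    · exact (((hc.mul_const y.1).const_add 1).smul_const (basisVec 0)).add
        ((hc.mul_const y.2).smul_const (basisVec 2))
    · exact (hasDerivAt_id τ).const_sub T₀
  have k' := (Real.hasDerivAt_rpow_const (x := τ) (p := κ) (Or.inl hτ.ne')).mul
    ((hG.differentiableAt (by simp)).hasFDerivAt.comp_hasDerivAt τ m)
  have := k.unique k'
  rw [this, dOne_scaled hτ hG, dTwo_scaled hτ hG]
  set A := fderiv ℝ G (scalePoint c T₀ (τ, y)) with hA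
  have e : (((c * τ ^ (c - 1) * y.1) • basisVec 0 + (c * τ ^ (c - 1) * y.2) • basisVec 2, -1) :
      Space3 × ℝ) = (c * τ ^ (c - 1) * y.1) • (basisVec 0, 0)
        + (c * τ ^ (c - 1) * y.2) • (basisVec 2, 0) - (0, 1) := by
    simp
  rw [e, map_sub, map_add, map_smul, map_smul, smul_eq_mul, smul_eq_mul,
    Real.rpow_sub_one hτ.ne', Real.rpow_sub_one hτ.ne']
  simp only [Function.comp, scaled]
  field_simp
  ring

end derivatives

/-- The rescaled velocity components. -/
noncomputable def scaledVelocity (κ c T₀ : ℝ) (v : ℝ → Space3 → Space3) (i : Fin 3) :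
    ℝ × ℝ × ℝ → ℝ :=
  scaled κ c T₀ fun q => v q.2 q.1 i

/-- The rescaled domain of the flow. -/
structure IsAdmissible (a b T₀ c τ : ℝ) (y : ℝ × ℝ) : Prop where
  time : τ ∈ Ioo 0 T₀
  inside : y.1 < 0
  radius_pos : 1 / 2 < 1 + τ ^ c * y.1
  height : τ ^ c * y.2 ∈ Ioo a b

namespace IsAdmissible

variable {c τ κ : ℝ} {y : ℝ × ℝ}

theorem radius_pos' (hy : IsAdmissible a b T₀ c τ y) : 0 < 1 + τ ^ c * y.1 := by
  linarith [hy.radius_pos]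

theorem radius_lt (hy : IsAdmissible a b T₀ c τ y) : 1 + τ ^ c * y.1 < 1 := by
  linarith [mul_neg_of_pos_of_neg (Real.rpow_pos_of_pos hy.time.1 c) hy.inside]

theorem time' (hy : IsAdmissible a b T₀ c τ y) : T₀ - τ ∈ Ioo 0 T₀ :=
  ⟨by linarith [hy.time.2], by linarith [hy.time.1]⟩

theorem mem (hy : IsAdmissible a b T₀ c τ y) :
    slicePoint (1 + τ ^ c * y.1) (τ ^ c * y.2) ∈ openCylinder a b :=
  slicePoint_mem_openCylinder hy.radius_pos'.le hy.radius_lt hy.height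

theorem contDiffAt_component (hy : IsAdmissible a b T₀ c τ y)
    (h : IsSmoothAxisymmetricEuler a b T₀ v p) (i : Fin 3) :
    ContDiffAt ℝ ∞ (fun q : Space3 × ℝ => v q.2 q.1 i) (scalePoint c T₀ (τ, y)) :=
  (EuclideanSpace.proj (𝕜 := ℝ) i).contDiff.contDiffAt.comp _
    (h.contDiffAt_velocity hy.mem hy.time')

theorem contDiffAt_pressure (hy : IsAdmissible a b T₀ c τ y)
    (h : IsSmoothAxisymmetricEuler a b T₀ v p) :
    ContDiffAt ℝ ∞ (fun q : Space3 × ℝ => p q.2 q.1) (scalePoint c T₀ (τ, y)) :=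
  h.contDiffAt_pressure hy.mem hy.time'

theorem contDiffAt_scaledVelocity (hy : IsAdmissible a b T₀ c τ y)
    (h : IsSmoothAxisymmetricEuler a b T₀ v p) (i : Fin 3) :
    ContDiffAt ℝ ∞ (scaledVelocity κ c T₀ v i) (τ, y) :=
  contDiffAt_scaled κ c T₀ hy.time.1 (hy.contDiffAt_component h i)

theorem contDiffAt_scaledPressure (hy : IsAdmissible a b T₀ c τ y)
    (h : IsSmoothAxisymmetricEuler a b T₀ v p) :
    ContDiffAt ℝ ∞ (scaled κ c T₀ fun q => p q.2 q.1) (τ, y) :=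
  contDiffAt_scaled κ c T₀ hy.time.1 (hy.contDiffAt_pressure h)

variable {α β : ℝ}

/-- The curvature term u_r / r has one space derivative fewer than the divergence, hence the extra
factor τ^c: planar incompressibility holds in the limit. -/
theorem scaled_divergence (hy : IsAdmissible a b T₀ c τ y)
    (h : IsSmoothAxisymmetricEuler a b T₀ v p) :
    dOne (fun y => scaledVelocity α c T₀ v 0 (τ, y)) y
      + dTwo (fun y => scaledVelocity α c T₀ v 2 (τ, y)) y
      = -(τ ^ c * scaledVelocity α c T₀ v 0 (τ, y) / (1 + τ ^ c * y.1)) := by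
  obtain ⟨-, -, -, e⟩ := h.slice_equations hy.radius_pos' hy.radius_lt hy.height hy.time' rfl
    (fun _ => rfl) rfl
  have hr := hy.radius_pos'.ne'
  unfold scaledVelocity
  rw [dOne_scaled hy.time.1 (hy.contDiffAt_component h 0),
    dTwo_scaled hy.time.1 (hy.contDiffAt_component h 2)]
  unfold scaled scalePoint
  simp only at e ⊢
  linear_combination τ ^ α * τ ^ c * e

theorem scaled_radial (hc : c = 1 - α) (hy : IsAdmissible a b T₀ c τ y)
    (h : IsSmoothAxisymmetricEuler a b T₀ v p) :
    τ * fderiv ℝ (scaledVelocity α c T₀ v 0) (τ, y) (1, 0)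
      = α * scaledVelocity α c T₀ v 0 (τ, y)
        + (c * y.1 + scaledVelocity α c T₀ v 0 (τ, y))
          * dOne (fun y => scaledVelocity α c T₀ v 0 (τ, y)) y
        + (c * y.2 + scaledVelocity α c T₀ v 2 (τ, y))
          * dTwo (fun y => scaledVelocity α c T₀ v 0 (τ, y)) y
        + (dOne (fun y => scaled (2 * α) c T₀ (fun q => p q.2 q.1) (τ, y)) y
          - τ ^ (1 - α - 2 * β) * scaledVelocity (α + β) c T₀ v 1 (τ, y) ^ 2
            / (1 + τ ^ c * y.1)) := by
  obtain ⟨e, -, -, -⟩ := h.slice_equations hy.radius_pos' hy.radius_lt hy.height hy.time' rfl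
    (fun _ => rfl) rfl
  have hτ := hy.time.1
  unfold scaledVelocity
  rw [mul_deriv_scaled hτ (hy.contDiffAt_component h 0),
    dOne_scaled hτ (hy.contDiffAt_component h 0), dTwo_scaled hτ (hy.contDiffAt_component h 0),
    dOne_scaled hτ (hy.contDiffAt_pressure h)]
  unfold scaled scalePoint
  simp only at e ⊢
  -- The choice c = 1 - α balances transport against τ ∂_τ. The pressure scales like a velocity
  -- squared, hence the weight 2α; the swirl, of size τ^(-(α + β)), leaves the factor τ^(1 - α - 2β)
  -- in the centrifugal term.
  have e₁ : τ ^ α * (τ ^ α * τ ^ c) = τ * τ ^ α := by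
    rw [← Real.rpow_add hτ, ← Real.rpow_add hτ, ← rpow_one_add_of_pos hτ, hc]
    congr 1; ring
  have e₂ : τ ^ (2 * α) * τ ^ c = τ * τ ^ α := by
    rw [← e₁, ← mul_assoc, ← Real.rpow_add hτ α α]
    congr 2; ring
  have e₃ : τ ^ (1 - α - 2 * β) * (τ ^ (α + β)) ^ 2 = τ * τ ^ α := by
    rw [sq, ← Real.rpow_add hτ, ← Real.rpow_add hτ, ← rpow_one_add_of_pos hτ]
    congr 1; ring
  rw [mul_pow, ← mul_assoc (τ ^ (1 - α - 2 * β)), e₃, e₂]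
  linear_combination (-(τ * τ ^ α)) * e
    - (v (T₀ - τ) (slicePoint (1 + τ ^ c * y.1) (τ ^ c * y.2)) 0
      * fderiv ℝ (fun q : Space3 × ℝ => v q.2 q.1 0)
        (slicePoint (1 + τ ^ c * y.1) (τ ^ c * y.2), T₀ - τ) (basisVec 0, 0)
      + v (T₀ - τ) (slicePoint (1 + τ ^ c * y.1) (τ ^ c * y.2)) 2
      * fderiv ℝ (fun q : Space3 × ℝ => v q.2 q.1 0)
        (slicePoint (1 + τ ^ c * y.1) (τ ^ c * y.2), T₀ - τ) (basisVec 2, 0)) * e₁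

theorem scaled_vertical (hc : c = 1 - α) (hy : IsAdmissible a b T₀ c τ y)
    (h : IsSmoothAxisymmetricEuler a b T₀ v p) :
    τ * fderiv ℝ (scaledVelocity α c T₀ v 2) (τ, y) (1, 0)
      = α * scaledVelocity α c T₀ v 2 (τ, y)
        + (c * y.1 + scaledVelocity α c T₀ v 0 (τ, y))
          * dOne (fun y => scaledVelocity α c T₀ v 2 (τ, y)) y
        + (c * y.2 + scaledVelocity α c T₀ v 2 (τ, y))
          * dTwo (fun y => scaledVelocity α c T₀ v 2 (τ, y)) y
        + dTwo (fun y => scaled (2 * α) c T₀ (fun q => p q.2 q.1) (τ, y)) y := by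
  obtain ⟨-, -, e, -⟩ := h.slice_equations hy.radius_pos' hy.radius_lt hy.height hy.time' rfl
    (fun _ => rfl) rfl
  have hτ := hy.time.1
  unfold scaledVelocity
  rw [mul_deriv_scaled hτ (hy.contDiffAt_component h 2),
    dOne_scaled hτ (hy.contDiffAt_component h 2), dTwo_scaled hτ (hy.contDiffAt_component h 2),
    dTwo_scaled hτ (hy.contDiffAt_pressure h)]
  unfold scaled scalePoint
  simp only at e ⊢
  have e₁ : τ ^ α * (τ ^ α * τ ^ c) = τ * τ ^ α := by
    rw [← Real.rpow_add hτ, ← Real.rpow_add hτ, ← rpow_one_add_of_pos hτ, hc]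
    congr 1; ring
  have e₂ : τ ^ (2 * α) * τ ^ c = τ * τ ^ α := by
    rw [← e₁, ← mul_assoc, ← Real.rpow_add hτ α α]
    congr 2; ring
  rw [e₂]
  linear_combination (-(τ * τ ^ α)) * e
    - (v (T₀ - τ) (slicePoint (1 + τ ^ c * y.1) (τ ^ c * y.2)) 0
      * fderiv ℝ (fun q : Space3 × ℝ => v q.2 q.1 2)
        (slicePoint (1 + τ ^ c * y.1) (τ ^ c * y.2), T₀ - τ) (basisVec 0, 0)
      + v (T₀ - τ) (slicePoint (1 + τ ^ c * y.1) (τ ^ c * y.2)) 2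
      * fderiv ℝ (fun q : Space3 × ℝ => v q.2 q.1 2)
        (slicePoint (1 + τ ^ c * y.1) (τ ^ c * y.2), T₀ - τ) (basisVec 2, 0)) * e₁

theorem scaled_swirl (hc : c = 1 - α) (hy : IsAdmissible a b T₀ c τ y)
    (h : IsSmoothAxisymmetricEuler a b T₀ v p) :
    τ * fderiv ℝ (scaledVelocity (α + β) c T₀ v 1) (τ, y) (1, 0)
      = (α + β) * scaledVelocity (α + β) c T₀ v 1 (τ, y)
        + (c * y.1 + scaledVelocity α c T₀ v 0 (τ, y))
          * dOne (fun y => scaledVelocity (α + β) c T₀ v 1 (τ, y)) y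
        + (c * y.2 + scaledVelocity α c T₀ v 2 (τ, y))
          * dTwo (fun y => scaledVelocity (α + β) c T₀ v 1 (τ, y)) y
        + τ ^ c * (scaledVelocity α c T₀ v 0 (τ, y) * scaledVelocity (α + β) c T₀ v 1 (τ, y))
          / (1 + τ ^ c * y.1) := by
  obtain ⟨-, e, -, -⟩ := h.slice_equations hy.radius_pos' hy.radius_lt hy.height hy.time' rfl
    (fun _ => rfl) rfl
  have hτ := hy.time.1
  unfold scaledVelocity
  rw [mul_deriv_scaled hτ (hy.contDiffAt_component h 1),
    dOne_scaled hτ (hy.contDiffAt_component h 1), dTwo_scaled hτ (hy.contDiffAt_component h 1)]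
  unfold scaled scalePoint
  simp only at e ⊢
  have e₁ : τ ^ α * τ ^ c = τ := by
    rw [← Real.rpow_add hτ, hc]
    simp
  set u := v (T₀ - τ) (slicePoint (1 + τ ^ c * y.1) (τ ^ c * y.2)) with hu
  set D := fderiv ℝ (fun q : Space3 × ℝ => v q.2 q.1 1)
    (slicePoint (1 + τ ^ c * y.1) (τ ^ c * y.2), T₀ - τ) with hD
  linear_combination (-(τ * τ ^ (α + β))) * e - (τ ^ (α + β) * (u 0 * D (basisVec 0, 0)
    + u 2 * D (basisVec 2, 0) + u 0 * u 1 / (1 + τ ^ c * y.1))) * e₁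

end IsAdmissible

/-! ### Locally uniform convergence of the rescaled fields -/

theorem tendsto_rpow_nhdsGT {s : ℝ} (hs : 0 < s) :
    Tendsto (fun τ : ℝ => τ ^ s) (𝓝[>] 0) (𝓝 0) := by
  have := (Real.continuous_rpow_const hs.le).tendsto 0
  rw [Real.zero_rpow hs.ne'] at this
  exact this.mono_left nhdsWithin_le_nhds

/-- Points of a compact set are close to the origin after rescaling. -/
theorem exists_forall_rescaled_small {K : Set (ℝ × ℝ)} (hK : IsCompact K) {c η : ℝ} (hc : 0 < c)
    (hη : 0 < η) :
    ∃ τ₀ > 0, ∀ τ ∈ Ioo 0 τ₀, ∀ y ∈ K, |τ ^ c * y.1| < η ∧ |τ ^ c * y.2| < η := by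
  obtain ⟨R, hR⟩ := hK.isBounded.exists_norm_le
  have h1 : Tendsto (fun τ : ℝ => τ ^ c * (|R| + 1)) (𝓝[>] 0) (𝓝 (0 * (|R| + 1))) :=
    (tendsto_rpow_nhdsGT hc).mul_const _
  rw [zero_mul] at h1
  obtain ⟨τ₀, hτ₀, hsub⟩ := mem_nhdsGT_iff_exists_Ioo_subset.1 (h1.eventually_lt_const hη)
  refine ⟨τ₀, hτ₀, fun τ hτ y hy => ?_⟩
  have h2 : τ ^ c * (|R| + 1) < η := hsub hτ
  have h3 : 0 < τ ^ c := Real.rpow_pos_of_pos hτ.1 c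
  have k1 : |y.1| ≤ |R| + 1 := by
    have := norm_fst_le y; have := hR y hy; have := le_abs_self R
    rw [← Real.norm_eq_abs]; linarith
  have k2 : |y.2| ≤ |R| + 1 := by
    have := norm_snd_le y; have := hR y hy; have := le_abs_self R
    rw [← Real.norm_eq_abs]; linarith
  rw [abs_mul, abs_mul, abs_of_pos h3]
  exact ⟨(mul_le_mul_of_nonneg_left k1 h3.le).trans_lt h2,
    (mul_le_mul_of_nonneg_left k2 h3.le).trans_lt h2⟩

theorem exists_forall_isAdmissible {K : Set (ℝ × ℝ)} (hK : IsCompact K) (hKH : K ⊆ openHalfPlane)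
    {c : ℝ} (hc : 0 < c) (ha : a < 0) (hb : 0 < b) (hT : 0 < T₀) :
    ∃ τ₀ > 0, ∀ τ ∈ Ioo 0 τ₀, ∀ y ∈ K, IsAdmissible a b T₀ c τ y := by
  obtain ⟨τ₁, h1, h2⟩ := exists_forall_rescaled_small hK hc
    (show 0 < min (1 / 2) (min (-a) b) from lt_min (by norm_num) (lt_min (by linarith) hb))
  refine ⟨min τ₁ T₀, lt_min h1 hT, fun τ hτ y hy => ?_⟩
  obtain ⟨k1, k2⟩ := h2 τ ⟨hτ.1, hτ.2.trans_le (min_le_left _ _)⟩ y hy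
  rw [lt_min_iff, lt_min_iff, abs_lt, abs_lt, abs_lt] at k1 k2
  exact ⟨⟨hτ.1, hτ.2.trans_le (min_le_right _ _)⟩, hKH hy, by linarith [k1.1.1],
    by linarith [k2.2.1.1], k2.2.2.2⟩

/-- The ansatz on the slice, in rescaled variables. -/
theorem scaledVelocity_of_ansatz {α β : ℝ} {Θ Vr V3 : ℝ × ℝ → ℝ} {ε : ℝ → ℝ}
    {W : ℝ → Space3 → Space3} (h : IsAsymptoticallySelfSimilar a b T₀ α β v Θ Vr V3 ε W)
    {τ : ℝ} {y : ℝ × ℝ} (hτ : 0 < τ) (hτT : τ ≤ T₀) (hy : y.1 ≤ 0)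
    (hr : 0 < 1 + τ ^ (1 - α) * y.1) (hz : τ ^ (1 - α) * y.2 ∈ Icc a b) :
    scaledVelocity α (1 - α) T₀ v 0 (τ, y) = Vr y + ε (T₀ - τ)
      * W (T₀ - τ) (slicePoint (1 + τ ^ (1 - α) * y.1) (τ ^ (1 - α) * y.2)) 0 ∧
    scaledVelocity α (1 - α) T₀ v 2 (τ, y) = V3 y + ε (T₀ - τ)
      * W (T₀ - τ) (slicePoint (1 + τ ^ (1 - α) * y.1) (τ ^ (1 - α) * y.2)) 2 ∧
    scaledVelocity (α + β) (1 - α) T₀ v 1 (τ, y) = Θ y + τ ^ β * (ε (T₀ - τ)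
      * W (T₀ - τ) (slicePoint (1 + τ ^ (1 - α) * y.1) (τ ^ (1 - α) * y.2)) 1) := by
  have hτc : 0 < τ ^ (1 - α) := Real.rpow_pos_of_pos hτ _
  have hrad := radius_slicePoint hr.le (τ ^ (1 - α) * y.2)
  have hcyl : slicePoint (1 + τ ^ (1 - α) * y.1) (τ ^ (1 - α) * y.2) ∈ cylinder a b := by
    refine ⟨hrad.trans_le ?_, by simpa [slicePoint] using hz⟩
    linarith [mul_nonpos_of_nonneg_of_nonpos hτc.le hy]
  have key := h.ansatz (T₀ - τ) ⟨by linarith, by linarith⟩ _ hcyl (by rwa [hrad])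
  have hself : selfSimilarVar α T₀ (T₀ - τ)
      (slicePoint (1 + τ ^ (1 - α) * y.1) (τ ^ (1 - α) * y.2)) = y := by
    rw [selfSimilarVar, hrad, sub_sub_cancel]
    refine Prod.ext ?_ ?_
    · simp only; field_simp; ring
    · simp [slicePoint]; field_simp
  rw [hself, sub_sub_cancel] at key
  have hR : eR (slicePoint (1 + τ ^ (1 - α) * y.1) (τ ^ (1 - α) * y.2)) = !₂[1, 0, 0] := by
    rw [eR, hrad]
    simp [slicePoint, div_self hr.ne']
  have hth : eTheta (slicePoint (1 + τ ^ (1 - α) * y.1) (τ ^ (1 - α) * y.2)) = !₂[0, 1, 0] := by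
    rw [eTheta, hrad]
    simp [slicePoint, div_self hr.ne']
  rw [hR, hth] at key
  have hα := (Real.rpow_pos_of_pos hτ α).ne'
  have hαβ := (Real.rpow_pos_of_pos hτ (α + β)).ne'
  have hβ : τ ^ (α + β) = τ ^ α * τ ^ β := Real.rpow_add hτ _ _
  unfold scaledVelocity scaled scalePoint
  simp only [key, eZ]
  refine ⟨?_, ?_, ?_⟩
  · simp; field_simp
  · simp; field_simp
  · simp only [PiLp.add_apply, PiLp.smul_apply, smul_eq_mul]
    simp
    rw [mul_add, mul_inv_cancel_left₀ hαβ, hβ]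
    field_simp

theorem dist_slicePoint_p0_le (r z : ℝ) : dist (slicePoint r z) p0 ≤ |r - 1| + |z| := by
  have : slicePoint r z - p0 = (r - 1) • basisVec 0 + z • basisVec 2 := by
    ext i; fin_cases i <;> simp [slicePoint, basisVec, p0]
  rw [dist_eq_norm, this]
  refine (norm_add_le _ _).trans ?_
  simp [norm_smul, basisVec]

/-- Convergence of the rescaled velocity to the profile, uniformly on compact sets. -/
theorem eventually_abs_scaledVelocity_sub_le {α β : ℝ} (hα : α < 1) (hβ : 0 < β) (ha : a < 0)
    (hb : 0 < b) (hT : 0 < T₀) {Θ Vr V3 : ℝ × ℝ → ℝ} {ε : ℝ → ℝ}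
    {W : ℝ → Space3 → Space3} (h : IsAsymptoticallySelfSimilar a b T₀ α β v Θ Vr V3 ε W)
    {K : Set (ℝ × ℝ)} (hK : IsCompact K) (hKH : K ⊆ halfPlane) :
    ∃ e : ℝ → ℝ, Tendsto e (𝓝[>] 0) (𝓝 0) ∧ ∀ᶠ τ in 𝓝[>] (0 : ℝ), ∀ y ∈ K,
      |scaledVelocity α (1 - α) T₀ v 0 (τ, y) - Vr y| ≤ e τ ∧
      |scaledVelocity α (1 - α) T₀ v 2 (τ, y) - V3 y| ≤ e τ ∧
      |scaledVelocity (α + β) (1 - α) T₀ v 1 (τ, y) - Θ y| ≤ e τ := by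
  obtain ⟨δ, hδ, M, hM⟩ := h.error_bounded_near
  obtain ⟨τ₁, h1, h2⟩ := exists_forall_rescaled_small hK (show 0 < 1 - α by linarith)
    -- 1/2 keeps the point away from the axis, δ/2 in each coordinate keeps it within δ of p₀, and
    -- the last minimum keeps it inside the cylinder.
    (show 0 < min (min (1 / 2) (δ / 2)) (min (-a) b) from
      lt_min (lt_min (by norm_num) (by linarith)) (lt_min (by linarith) hb))
  have hT' : Tendsto (fun τ : ℝ => T₀ - τ) (𝓝[>] 0) (𝓝[<] T₀) := by
    refine tendsto_nhdsWithin_iff.2 ⟨?_, ?_⟩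
    · have : Tendsto (fun τ : ℝ => T₀ - τ) (𝓝 0) (𝓝 (T₀ - 0)) :=
        (show Continuous (fun τ : ℝ => T₀ - τ) by fun_prop).tendsto 0
      rw [sub_zero] at this
      exact this.mono_left nhdsWithin_le_nhds
    · filter_upwards [self_mem_nhdsWithin] with τ hτ
      have : 0 < τ := hτ
      exact show T₀ - τ < T₀ by linarith
  refine ⟨fun τ => |ε (T₀ - τ)| * M, ?_, ?_⟩
  · have := ((h.small.comp hT').abs).mul_const M
    simpa using this
  · filter_upwards [Ioo_mem_nhdsGT h1, Ioo_mem_nhdsGT hT, Ioo_mem_nhdsGT hδ,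
      Ioo_mem_nhdsGT one_pos] with τ hτ1 hτT hτδ hτ01 y hy
    obtain ⟨k1, k2⟩ := h2 τ hτ1 y hy
    rw [lt_min_iff, lt_min_iff, lt_min_iff] at k1 k2
    have hr : 0 < 1 + τ ^ (1 - α) * y.1 := by linarith [(abs_lt.1 k1.1.1).1]
    have hz : τ ^ (1 - α) * y.2 ∈ Icc a b :=
      ⟨by linarith [(abs_lt.1 k2.2.1).1], by linarith [(abs_lt.1 k2.2.2).2]⟩
    have hy1 : y.1 ≤ 0 := hKH hy
    obtain ⟨e1, e2, e3⟩ := scaledVelocity_of_ansatz h hτT.1 hτT.2.le hy1 hr hz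
    set X := slicePoint (1 + τ ^ (1 - α) * y.1) (τ ^ (1 - α) * y.2) with hX
    have hcyl : X ∈ cylinder a b := by
      refine ⟨(radius_slicePoint hr.le _).trans_le ?_, by simpa [hX, slicePoint] using hz⟩
      linarith [mul_nonpos_of_nonneg_of_nonpos (Real.rpow_pos_of_pos hτT.1 (1 - α)).le hy1]
    have hdist : dist X p0 < δ := by
      refine (dist_slicePoint_p0_le _ _).trans_lt ?_
      rw [add_sub_cancel_left]
      linarith [k1.1.2, k2.1.2]
    have hW := hM (T₀ - τ) ⟨by linarith [hτT.2], by linarith [hτT.1]⟩ (by linarith [hτδ.2]) X hcyl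
      hdist
    have hWi : ∀ i, |ε (T₀ - τ) * W (T₀ - τ) X i| ≤ |ε (T₀ - τ)| * M := fun i => by
      rw [abs_mul]
      exact mul_le_mul_of_nonneg_left ((PiLp.norm_apply_le _ i).trans hW) (abs_nonneg _)
    refine ⟨by rw [e1, add_sub_cancel_left]; exact hWi 0,
      by rw [e2, add_sub_cancel_left]; exact hWi 2, ?_⟩
    -- The error is measured on the scale τ^(-α) of the meridional velocity; relative to the larger
    -- swirl scale it gains τ^β ≤ 1.
    rw [e3, add_sub_cancel_left, abs_mul, abs_of_pos (Real.rpow_pos_of_pos hτT.1 β)]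
    refine (mul_le_of_le_one_left (abs_nonneg _) ?_).trans (hWi 1)
    exact Real.rpow_le_one hτT.1.le hτ01.2.le hβ.le

theorem tendstoUniformlyOn_of_abs_sub_le {F : ℝ → ℝ × ℝ → ℝ} {f : ℝ × ℝ → ℝ} {K : Set (ℝ × ℝ)}
    {e : ℝ → ℝ} (he : Tendsto e (𝓝[>] 0) (𝓝 0))
    (h : ∀ᶠ τ in 𝓝[>] (0 : ℝ), ∀ y ∈ K, |F τ y - f y| ≤ e τ) :
    TendstoUniformlyOn F f (𝓝[>] 0) K := by
  rw [Metric.tendstoUniformlyOn_iff]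
  intro η hη
  filter_upwards [h, he.eventually_lt_const hη] with τ h1 h2 y hy
  rw [dist_comm, Real.dist_eq]
  exact (h1 y hy).trans_lt h2

/-- A term with a positive power of `τ` in front vanishes in the limit. -/
theorem tendstoUniformlyOn_rpow_mul_div {F : ℝ → ℝ × ℝ → ℝ} {f : ℝ × ℝ → ℝ} {K : Set (ℝ × ℝ)}
    (hK : IsCompact K) (hF : TendstoUniformlyOn F f (𝓝[>] 0) K) (hf : ContinuousOn f K) {c s : ℝ}
    (hc : 0 < c) (hs : 0 < s) :
    TendstoUniformlyOn (fun τ y => τ ^ s * F τ y / (1 + τ ^ c * y.1)) (fun _ => 0) (𝓝[>] 0) K := by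
  obtain ⟨A, hA⟩ := hK.exists_bound_of_continuousOn hf
  obtain ⟨τ₀, h0, h1⟩ := exists_forall_rescaled_small hK hc (show (0 : ℝ) < 1 / 2 by norm_num)
  have he := (tendsto_rpow_nhdsGT hs).mul_const ((A + 1) * 2)
  rw [zero_mul] at he
  refine tendstoUniformlyOn_of_abs_sub_le he ?_
  filter_upwards [Ioo_mem_nhdsGT h0, Metric.tendstoUniformlyOn_iff.1 hF 1 one_pos] with τ hτ hd y hy
  have h2 := (abs_lt.1 (h1 τ hτ y hy).1).1
  have h3 : |F τ y| ≤ A + 1 := by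
    have k := hd y hy
    rw [dist_comm, Real.dist_eq] at k
    have k2 := hA y hy
    rw [Real.norm_eq_abs] at k2
    have := abs_add_le (F τ y - f y) (f y)
    rw [sub_add_cancel] at this
    linarith
  have h4 : 0 < τ ^ s := Real.rpow_pos_of_pos hτ.1 s
  rw [sub_zero, abs_div, abs_mul, abs_of_pos h4, abs_of_pos (by linarith : 0 < 1 + τ ^ c * y.1),
    div_le_iff₀ (by linarith), mul_assoc]
  refine mul_le_mul_of_nonneg_left ?_ h4.le
  have := abs_nonneg (F τ y)
  nlinarith

theorem contDiffAt_two_of_halfPlane {F : ℝ × ℝ → ℝ} (hF : ContDiffOn ℝ 2 F halfPlane) {y : ℝ × ℝ}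
    (hy : y ∈ openHalfPlane) : ContDiffAt ℝ 2 F y :=
  hF.contDiffAt (halfPlane_mem_nhds hy)

theorem contDiffAt_one_of_halfPlane {F : ℝ × ℝ → ℝ} (hF : ContDiffOn ℝ 2 F halfPlane) {y : ℝ × ℝ}
    (hy : y ∈ openHalfPlane) : ContDiffAt ℝ 1 F y :=
  (contDiffAt_two_of_halfPlane hF hy).of_le (by norm_num)

theorem continuousOn_of_halfPlane {F : ℝ × ℝ → ℝ} (hF : ContDiffOn ℝ 2 F halfPlane) {K : Set (ℝ × ℝ)}
    (hKH : K ⊆ openHalfPlane) : ContinuousOn F K :=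
  hF.continuousOn.mono (hKH.trans openHalfPlane_subset)

/-! ### Equations for the profile and the contradiction -/

/-- The data of an asymptotically self-similar solution, with `α + 2 β < 1`. -/
structure BlowupData (a b T₀ α β : ℝ) (v : ℝ → Space3 → Space3) (p : ℝ → Space3 → ℝ)
    (Θ Vr V3 : ℝ × ℝ → ℝ) (ε : ℝ → ℝ) (W : ℝ → Space3 → Space3) : Prop where
  alpha : α < 0
  beta : 0 < β
  sum_lt : 0 < 1 - α - 2 * β
  bot : a < 0
  top : 0 < b
  time : 0 < T₀
  euler : IsSmoothAxisymmetricEuler a b T₀ v p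
  ansatz : IsAsymptoticallySelfSimilar a b T₀ α β v Θ Vr V3 ε W
  swirl : ContDiffOn ℝ 2 Θ halfPlane
  radial : ContDiffOn ℝ 2 Vr halfPlane
  vertical : ContDiffOn ℝ 2 V3 halfPlane

namespace BlowupData

variable {α β : ℝ} {Θ Vr V3 : ℝ × ℝ → ℝ} {ε : ℝ → ℝ} {W : ℝ → Space3 → Space3}

theorem exponent_pos (h : BlowupData a b T₀ α β v p Θ Vr V3 ε W) : 0 < 1 - α := by linarith [h.alpha]

/-- The line y₁ = 0 corresponds to the wall r = 1, where the radial velocity is exactly 0 at all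
times; pass to the limit. -/
theorem radial_eq_zero (h : BlowupData a b T₀ α β v p Θ Vr V3 ε W)
    {y : ℝ × ℝ} (hy : y.1 = 0) : Vr y = 0 := by
  obtain ⟨e, he, hev⟩ := eventually_abs_scaledVelocity_sub_le (by linarith [h.alpha]) h.beta h.bot
    h.top h.time h.ansatz (isCompact_singleton (x := y)) (by simp [halfPlane, hy])
  obtain ⟨τ₁, h1, h2⟩ := exists_forall_rescaled_small (isCompact_singleton (x := y))
    h.exponent_pos (show 0 < min (-a) b from lt_min (by linarith [h.bot]) h.top)
  rw [← abs_nonpos_iff]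
  refine ge_of_tendsto he ?_
  filter_upwards [hev, Ioo_mem_nhdsGT h1, Ioo_mem_nhdsGT h.time] with τ hτ hτ1 hτT
  have k := (hτ y rfl).1
  have k2 := (h2 τ hτ1 y rfl).2
  rw [lt_min_iff] at k2
  have hz : τ ^ (1 - α) * y.2 ∈ Icc a b :=
    ⟨by linarith [(abs_lt.1 k2.1).1], by linarith [(abs_lt.1 k2.2).2]⟩
  have hrad := radius_slicePoint zero_le_one (τ ^ (1 - α) * y.2)
  have hn := h.euler.no_penetration (T₀ - τ) ⟨by linarith [hτT.2], by linarith [hτT.1]⟩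
    (slicePoint 1 (τ ^ (1 - α) * y.2)) ⟨hrad.le, by simpa [slicePoint] using hz⟩ hrad
  rw [eR, hrad, PiLp.inner_apply, Fin.sum_univ_three] at hn
  simp [slicePoint] at hn
  rw [scaledVelocity, scaled, scalePoint] at k
  simp only [hy, mul_zero, add_zero, slicePoint, hn, zero_sub, abs_neg] at k
  exact k

theorem tendsto_scaledVelocity (h : BlowupData a b T₀ α β v p Θ Vr V3 ε W)
    {K : Set (ℝ × ℝ)} (hK : IsCompact K) (hKH : K ⊆ openHalfPlane) :
    TendstoUniformlyOn (fun τ y => scaledVelocity α (1 - α) T₀ v 0 (τ, y)) Vr (𝓝[>] 0) K ∧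
    TendstoUniformlyOn (fun τ y => scaledVelocity α (1 - α) T₀ v 2 (τ, y)) V3 (𝓝[>] 0) K ∧
    TendstoUniformlyOn (fun τ y => scaledVelocity (α + β) (1 - α) T₀ v 1 (τ, y)) Θ (𝓝[>] 0) K := by
  obtain ⟨e, he, hev⟩ := eventually_abs_scaledVelocity_sub_le (by linarith [h.alpha]) h.beta h.bot
    h.top h.time h.ansatz hK (hKH.trans openHalfPlane_subset)
  exact ⟨tendstoUniformlyOn_of_abs_sub_le he (hev.mono fun τ k y hy => (k y hy).1),
    tendstoUniformlyOn_of_abs_sub_le he (hev.mono fun τ k y hy => (k y hy).2.1),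
    tendstoUniformlyOn_of_abs_sub_le he (hev.mono fun τ k y hy => (k y hy).2.2)⟩

theorem tendsto_divergence (h : BlowupData a b T₀ α β v p Θ Vr V3 ε W)
    {K : Set (ℝ × ℝ)} (hK : IsCompact K) (hKH : K ⊆ openHalfPlane) :
    TendstoUniformlyOn (fun τ y => dOne (fun y => scaledVelocity α (1 - α) T₀ v 0 (τ, y)) y
      + dTwo (fun y => scaledVelocity α (1 - α) T₀ v 2 (τ, y)) y) (fun _ => 0) (𝓝[>] 0) K := by
  obtain ⟨τ₀, h0, hadm⟩ := exists_forall_isAdmissible hK hKH h.exponent_pos h.bot h.top h.time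
  have k := tendstoUniformlyOn_rpow_mul_div hK (h.tendsto_scaledVelocity hK hKH).1
    (continuousOn_of_halfPlane h.radial hKH) h.exponent_pos h.exponent_pos
  rw [Metric.tendstoUniformlyOn_iff] at k ⊢
  intro η hη
  filter_upwards [k η hη, Ioo_mem_nhdsGT h0] with τ k1 hτ y hy
  rw [(hadm τ hτ y hy).scaled_divergence h.euler, dist_zero_left, norm_neg]
  simpa using k1 y hy

theorem div_eq_zero (h : BlowupData a b T₀ α β v p Θ Vr V3 ε W) : ∀ y ∈ openHalfPlane, dOne Vr y + dTwo V3 y = 0 := by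
  refine div_eq_zero_of_weak (fun y hy => contDiffAt_one_of_halfPlane h.radial hy)
    (fun y hy => contDiffAt_one_of_halfPlane h.vertical hy) fun ψ hψ => ?_
  have hK : IsCompact (tsupport ψ) := hψ.compact
  obtain ⟨τ₀, h0, hadm⟩ := exists_forall_isAdmissible hK hψ.subset h.exponent_pos h.bot h.top h.time
  obtain ⟨l₁, l₂, -⟩ := h.tendsto_scaledVelocity hK hψ.subset
  have hsm : ∀ᶠ τ in 𝓝[>] (0 : ℝ), τ ∈ Ioo 0 τ₀ := Ioo_mem_nhdsGT h0
  have cd : ∀ τ ∈ Ioo 0 τ₀, ∀ i, ∀ y ∈ tsupport ψ,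
      ContDiffAt ℝ 1 (fun y => scaledVelocity α (1 - α) T₀ v i (τ, y)) y := fun τ hτ i y hy =>
    (contDiffAt_slice ((hadm τ hτ y hy).contDiffAt_scaledVelocity h.euler i)).of_le (by simp)
  have co : ∀ τ ∈ Ioo 0 τ₀, ∀ i,
      ContinuousOn (fun y => scaledVelocity α (1 - α) T₀ v i (τ, y)) (tsupport ψ) :=
    fun τ hτ i y hy => (cd τ hτ i y hy).continuousAt.continuousWithinAt
  have cD : ∀ τ ∈ Ioo 0 τ₀, ContinuousOn
      (fun y => dOne (fun y => scaledVelocity α (1 - α) T₀ v 0 (τ, y)) y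
        + dTwo (fun y => scaledVelocity α (1 - α) T₀ v 2 (τ, y)) y) (tsupport ψ) := fun τ hτ =>
    (continuousOn_fderiv_apply (cd τ hτ 0) _).add (continuousOn_fderiv_apply (cd τ hτ 2) _)
  have t₁ := tendsto_integral_mul_of_tendstoUniformlyOn hK l₁
    (hsm.mono fun τ hτ => co τ hτ 0) (continuousOn_of_halfPlane h.radial hψ.subset) hψ.dOne.continuous
    (tsupport_fderiv_apply ψ _)
  have t₂ := tendsto_integral_mul_of_tendstoUniformlyOn hK l₂
    (hsm.mono fun τ hτ => co τ hτ 2) (continuousOn_of_halfPlane h.vertical hψ.subset) hψ.dTwo.continuous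
    (tsupport_fderiv_apply ψ _)
  have t₃ := tendsto_integral_mul_of_tendstoUniformlyOn hK (h.tendsto_divergence hK hψ.subset)
    (hsm.mono cD) continuousOn_const hψ.continuous le_rfl
  simp only [zero_mul, integral_zero] at t₃
  have t₃' := t₃.neg
  rw [neg_zero] at t₃'
  refine tendsto_nhds_unique (t₁.add t₂) (t₃'.congr' ?_)
  filter_upwards [hsm] with τ hτ
  have i₁ := integral_mul_fderiv_test hψ (cd τ hτ 0) (1, 0)
  have i₂ := integral_mul_fderiv_test hψ (cd τ hτ 2) (0, 1)
  have e := integral_add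
    (integrable_mul_test hK (continuousOn_fderiv_apply (cd τ hτ 0) (1, 0)) hψ.continuous le_rfl)
    (integrable_mul_test hK (continuousOn_fderiv_apply (cd τ hτ 2) (0, 1)) hψ.continuous le_rfl)
  simp only [add_mul]
  unfold dOne dTwo
  rw [e, i₁, i₂]
  ring

/-- Testing the radial equation with ∂₂ψ and the vertical one with ∂₁ψ, then subtracting, cancels
the pressure at every τ, before any limit is taken. -/
theorem weak_momentum (h : BlowupData a b T₀ α β v p Θ Vr V3 ε W)
    {ψ : ℝ × ℝ → ℝ} (hψ : IsTest openHalfPlane ψ) :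
    (∫ y, (α * Vr y + ((1 - α) * y.1 + Vr y) * dOne Vr y + ((1 - α) * y.2 + V3 y) * dTwo Vr y)
      * dTwo ψ y)
    - ∫ y, (α * V3 y + ((1 - α) * y.1 + Vr y) * dOne V3 y + ((1 - α) * y.2 + V3 y) * dTwo V3 y)
      * dOne ψ y = 0 := by
  have hK : IsCompact (tsupport ψ) := hψ.compact
  have s₁ : tsupport (dOne ψ) ⊆ tsupport ψ := tsupport_fderiv_apply ψ _
  have s₂ : tsupport (dTwo ψ) ⊆ tsupport ψ := tsupport_fderiv_apply ψ _
  obtain ⟨τ₀, h0, hadm⟩ := exists_forall_isAdmissible hK hψ.subset h.exponent_pos h.bot h.top h.time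
  obtain ⟨l₁, l₂, l₃⟩ := h.tendsto_scaledVelocity hK hψ.subset
  have lD := h.tendsto_divergence hK hψ.subset
  have hsm : ∀ᶠ τ in 𝓝[>] (0 : ℝ), τ ∈ Ioo 0 τ₀ := Ioo_mem_nhdsGT h0
  have cd : ∀ κ, ∀ i, ∀ τ ∈ Ioo 0 τ₀, ∀ y ∈ tsupport ψ,
      ContDiffAt ℝ 1 (scaledVelocity κ (1 - α) T₀ v i) (τ, y) := fun κ i τ hτ y hy =>
    ((hadm τ hτ y hy).contDiffAt_scaledVelocity h.euler i).of_le (by simp)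
  have cV₁ := fun y hy => contDiffAt_one_of_halfPlane h.radial (y := y) hy
  have cV₂ := fun y hy => contDiffAt_one_of_halfPlane h.vertical (y := y) hy
  have r := tendsto_weak_transport hψ.dTwo (τ₀ := τ₀) h0
    (fun τ hτ y hy => cd α 0 τ hτ y (s₂ hy)) (fun τ hτ y hy => cd α 0 τ hτ y (s₂ hy))
    (fun τ hτ y hy => cd α 2 τ hτ y (s₂ hy))
    (S := fun τ y => dOne (fun y => scaled (2 * α) (1 - α) T₀ (fun q => p q.2 q.1) (τ, y)) y
      - τ ^ (1 - α - 2 * β) * scaledVelocity (α + β) (1 - α) T₀ v 1 (τ, y) ^ 2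
        / (1 + τ ^ (1 - α) * y.1))
    (fun τ hτ y hy => (hadm τ hτ y (s₂ hy)).scaled_radial rfl h.euler)
    cV₁ cV₁ cV₂ h.div_eq_zero (l₁.mono s₂) (l₁.mono s₂) (l₂.mono s₂) (lD.mono s₂)
  have z := tendsto_weak_transport hψ.dOne (τ₀ := τ₀) h0
    (fun τ hτ y hy => cd α 2 τ hτ y (s₁ hy)) (fun τ hτ y hy => cd α 0 τ hτ y (s₁ hy))
    (fun τ hτ y hy => cd α 2 τ hτ y (s₁ hy))
    (S := fun τ y => dTwo (fun y => scaled (2 * α) (1 - α) T₀ (fun q => p q.2 q.1) (τ, y)) y)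
    (fun τ hτ y hy => (hadm τ hτ y (s₁ hy)).scaled_vertical rfl h.euler)
    cV₂ cV₁ cV₂ h.div_eq_zero (l₂.mono s₁) (l₁.mono s₁) (l₂.mono s₁) (lD.mono s₁)
  -- the swirl term is negligible
  have cΘ := continuousOn_of_halfPlane h.swirl hψ.subset
  obtain ⟨A, hA⟩ := hK.exists_bound_of_continuousOn cΘ
  have lE := tendstoUniformlyOn_rpow_mul_div hK (TendstoUniformlyOn.mul_of_bounded l₃ l₃ hA hA)
    (cΘ.mul cΘ) h.exponent_pos h.sum_lt
  have cE : ∀ τ ∈ Ioo 0 τ₀, ContinuousOn (fun y : ℝ × ℝ => τ ^ (1 - α - 2 * β)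
      * (scaledVelocity (α + β) (1 - α) T₀ v 1 (τ, y) * scaledVelocity (α + β) (1 - α) T₀ v 1 (τ, y))
      / (1 + τ ^ (1 - α) * y.1)) (tsupport ψ) := by
    intro τ hτ
    have cq : ContinuousOn (fun y => scaledVelocity (α + β) (1 - α) T₀ v 1 (τ, y)) (tsupport ψ) :=
      fun y hy => (contDiffAt_slice (cd (α + β) 1 τ hτ y hy)).continuousAt.continuousWithinAt
    exact ((cq.mul cq).const_mul _).div (by fun_prop)
      fun y hy => (hadm τ hτ y hy).radius_pos'.ne'
  have tE := tendsto_integral_mul_of_tendstoUniformlyOn hK lE (hsm.mono cE) continuousOn_const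
    hψ.dTwo.continuous s₂
  simp only [zero_mul, integral_zero] at tE
  -- Applied to g(τ) = ∫ U_r ∂₂ψ - ∫ U_3 ∂₁ψ, the pairing of the rescaled velocity with the
  -- perpendicular gradient of ψ.
  refine eq_zero_of_tendsto_mul_deriv h0
    (fun τ hτ => (hasDerivAt_integral_test hψ.dTwo (fun τ hτ y hy => cd α 0 τ hτ y (s₂ hy)) hτ).sub
      (hasDerivAt_integral_test hψ.dOne (fun τ hτ y hy => cd α 2 τ hτ y (s₁ hy)) hτ))
    (r.1.sub z.1) ?_
  have key := (r.2.sub z.2).sub tE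
  rw [sub_zero] at key
  refine key.congr' ?_
  filter_upwards [hsm] with τ hτ
  have cP : ∀ y ∈ tsupport ψ, ContDiffAt ℝ 1
      (fun y => scaled (2 * α) (1 - α) T₀ (fun q => p q.2 q.1) (τ, y)) y := fun y hy =>
    (contDiffAt_slice ((hadm τ hτ y hy).contDiffAt_scaledPressure h.euler)).of_le (by simp)
  have hP := integral_grad_mul_perp hψ cP
  have e := integral_sub
    (integrable_mul_test hK (continuousOn_fderiv_apply cP (1, 0)) hψ.dTwo.continuous s₂)
    (integrable_mul_test hK (cE τ hτ) hψ.dTwo.continuous s₂)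
  have e' : (∫ y, (dOne (fun y => scaled (2 * α) (1 - α) T₀ (fun q => p q.2 q.1) (τ, y)) y
      - τ ^ (1 - α - 2 * β) * scaledVelocity (α + β) (1 - α) T₀ v 1 (τ, y) ^ 2
        / (1 + τ ^ (1 - α) * y.1)) * dTwo ψ y)
      = (∫ y, dOne (fun y => scaled (2 * α) (1 - α) T₀ (fun q => p q.2 q.1) (τ, y)) y * dTwo ψ y)
        - ∫ y, τ ^ (1 - α - 2 * β) * (scaledVelocity (α + β) (1 - α) T₀ v 1 (τ, y)
          * scaledVelocity (α + β) (1 - α) T₀ v 1 (τ, y)) / (1 + τ ^ (1 - α) * y.1)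
          * dTwo ψ y := by
    refine Eq.trans ?_ e
    congr 1
    ext y
    simp only [dOne]
    ring
  rw [e']
  linear_combination -hP

theorem velocity_eq_zero (h : BlowupData a b T₀ α β v p Θ Vr V3 ε W)
    (s₁ : IsSublinear Vr) (s₂ : IsSublinear V3)
    (g₁ : HasBoundedGradient Vr) (g₂ : HasBoundedGradient V3)
    (hodd : ∀ y ∈ halfPlane, V3 (y.1, -y.2) = -V3 y) : ∀ y ∈ halfPlane, Vr y = 0 ∧ V3 y = 0 := by
  refine velocity_profile_eq_zero h.exponent_pos h.radial h.vertical s₁ s₂ g₁ g₂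
    (fun y hy => h.radial_eq_zero hy) hodd h.div_eq_zero ?_
  have k := vorticity_of_weak (κ := α) (c := 1 - α) (fun y hy => contDiffAt_two_of_halfPlane h.radial hy)
    (fun y hy => contDiffAt_two_of_halfPlane h.vertical hy) h.div_eq_zero fun ψ hψ => h.weak_momentum hψ
  -- The coefficient of ω is κ + c = α + (1 - α) = 1.
  simpa using k

theorem swirl_equation (h : BlowupData a b T₀ α β v p Θ Vr V3 ε W) :
    ∀ y ∈ openHalfPlane, (α + β) * Θ y
    + ((1 - α) * y.1 + Vr y) * dOne Θ y + ((1 - α) * y.2 + V3 y) * dTwo Θ y = 0 := by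
  have cΘ := fun y hy => contDiffAt_one_of_halfPlane h.swirl (y := y) hy
  have cV₁ := fun y hy => contDiffAt_one_of_halfPlane h.radial (y := y) hy
  have cV₂ := fun y hy => contDiffAt_one_of_halfPlane h.vertical (y := y) hy
  refine eqOn_zero_of_integral_test isOpen_openHalfPlane ?_ fun φ hφ => ?_
  · have d₁ : ContinuousOn (dOne Θ) openHalfPlane := continuousOn_fderiv_apply cΘ _
    have d₂ : ContinuousOn (dTwo Θ) openHalfPlane := continuousOn_fderiv_apply cΘ _
    have := continuousOn_of_halfPlane h.swirl le_rfl
    have := continuousOn_of_halfPlane h.radial le_rfl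
    have := continuousOn_of_halfPlane h.vertical le_rfl
    fun_prop
  have hK : IsCompact (tsupport φ) := hφ.compact
  obtain ⟨τ₀, h0, hadm⟩ := exists_forall_isAdmissible hK hφ.subset h.exponent_pos h.bot h.top h.time
  obtain ⟨l₁, l₂, l₃⟩ := h.tendsto_scaledVelocity hK hφ.subset
  have hsm : ∀ᶠ τ in 𝓝[>] (0 : ℝ), τ ∈ Ioo 0 τ₀ := Ioo_mem_nhdsGT h0
  have cd : ∀ κ, ∀ i, ∀ τ ∈ Ioo 0 τ₀, ∀ y ∈ tsupport φ,
      ContDiffAt ℝ 1 (scaledVelocity κ (1 - α) T₀ v i) (τ, y) := fun κ i τ hτ y hy =>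
    ((hadm τ hτ y hy).contDiffAt_scaledVelocity h.euler i).of_le (by simp)
  have r := tendsto_weak_transport hφ (τ₀ := τ₀) h0 (cd (α + β) 1) (cd α 0) (cd α 2)
    (S := fun τ y => τ ^ (1 - α) * (scaledVelocity α (1 - α) T₀ v 0 (τ, y)
      * scaledVelocity (α + β) (1 - α) T₀ v 1 (τ, y)) / (1 + τ ^ (1 - α) * y.1))
    (fun τ hτ y hy => (hadm τ hτ y hy).scaled_swirl rfl h.euler)
    cΘ cV₁ cV₂ h.div_eq_zero l₃ l₁ l₂ (h.tendsto_divergence hK hφ.subset)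
  have coΘ := continuousOn_of_halfPlane h.swirl hφ.subset
  have coV := continuousOn_of_halfPlane h.radial hφ.subset
  obtain ⟨A, hA⟩ := hK.exists_bound_of_continuousOn coΘ
  obtain ⟨B, hB⟩ := hK.exists_bound_of_continuousOn coV
  have lE := tendstoUniformlyOn_rpow_mul_div hK (TendstoUniformlyOn.mul_of_bounded l₁ l₃ hB hA)
    (coV.mul coΘ) h.exponent_pos h.exponent_pos
  have cE : ∀ τ ∈ Ioo 0 τ₀, ContinuousOn (fun y : ℝ × ℝ => τ ^ (1 - α)
      * (scaledVelocity α (1 - α) T₀ v 0 (τ, y) * scaledVelocity (α + β) (1 - α) T₀ v 1 (τ, y))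
      / (1 + τ ^ (1 - α) * y.1)) (tsupport φ) := by
    intro τ hτ
    have cq : ∀ κ i, ContinuousOn (fun y => scaledVelocity κ (1 - α) T₀ v i (τ, y)) (tsupport φ) :=
      fun κ i y hy => (contDiffAt_slice (cd κ i τ hτ y hy)).continuousAt.continuousWithinAt
    exact (((cq α 0).mul (cq (α + β) 1)).const_mul _).div (by fun_prop)
      fun y hy => (hadm τ hτ y hy).radius_pos'.ne'
  have tE := tendsto_integral_mul_of_tendstoUniformlyOn hK lE (hsm.mono cE) continuousOn_const
    hφ.continuous le_rfl
  simp only [zero_mul, integral_zero] at tE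
  refine eq_zero_of_tendsto_mul_deriv h0
    (fun τ hτ => hasDerivAt_integral_test hφ (cd (α + β) 1) hτ) r.1 ?_
  simpa using r.2.add tE

/-- With trivial velocity profile and globally bounded error the swirl profile is trivial. -/
theorem swirl_eq_zero (h : BlowupData a b T₀ α β v p Θ Vr V3 ε W)
    (hV : ∀ y ∈ halfPlane, Vr y = 0 ∧ V3 y = 0)
    (hW : IsGloballyBounded a b T₀ W) : ∀ y ∈ halfPlane, Θ y = 0 := by
  have hk := swirl_profile_eq_const (F := Θ) (k := α + β) h.exponent_pos (by linarith [h.beta])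
    (h.swirl.of_le (by norm_num)) fun y hy => by
      have := h.swirl_equation y hy
      obtain ⟨e₁, e₂⟩ := hV y (openHalfPlane_subset hy)
      rw [e₁, e₂, add_zero, add_zero] at this
      exact this
  intro y hy
  by_contra hne
  have hαβ : α + β = 0 := by
    by_contra h0
    exact hne ((hk y hy).2 h0)
  set d := Θ 0 with hd
  have hd0 : d ≠ 0 := by rwa [← (hk y hy).1]
  obtain ⟨M, hM⟩ := hW
  have hsmall : Tendsto (fun t => |ε t| * |M|) (𝓝[<] T₀) (𝓝 0) := by
    simpa using h.ansatz.small.abs.mul_const |M|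
  -- T₀ - t < 1 together with α < 0 gives (T₀ - t)^α ≥ 1, so the factor in front of W is at most
  -- |ε(t)|.
  have hev : ∀ᶠ t in 𝓝[<] T₀, t ∈ Ioo (max 0 (T₀ - 1)) T₀ :=
    Ioo_mem_nhdsLT (max_lt h.time (by linarith))
  obtain ⟨t, hεt, ht⟩ := ((hsmall.eventually_lt_const (show 0 < |d| / 2 by positivity)).and
    hev).exists
  have ht0 : t ∈ Ico 0 T₀ := ⟨(le_max_left _ _).trans ht.1.le, ht.2⟩
  have ht1 : T₀ - t < 1 := by have := (le_max_right 0 (T₀ - 1)).trans_lt ht.1; linarith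
  have htpos : 0 < T₀ - t := by linarith [ht.2]
  have hmem : ∀ s ∈ Icc (0 : ℝ) 1, slicePoint s 0 ∈ cylinder a b := fun s hs =>
    ⟨(radius_slicePoint hs.1 0).trans_le hs.2, by simpa [slicePoint] using ⟨h.bot.le, h.top.le⟩⟩
  have hslice0 : slicePoint 0 0 = 0 := by ext i; fin_cases i <;> simp [slicePoint]
  -- A point of the axis is fixed by rotation through π, which reverses horizontal vectors.
  have hzero : v t (slicePoint 0 0) 1 = 0 := by
    have k := h.euler.equivariant (hmem 0 ⟨le_rfl, zero_le_one⟩) ht0 Real.pi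
    rw [hslice0, map_zero, rot_apply] at k
    have := congrArg (fun w : Space3 => w 1) k
    simp at this
    rw [hslice0]
    linarith
  have hcont : Tendsto (fun s : ℝ => v t (slicePoint s 0) 1) (𝓝[>] 0) (𝓝 0) := by
    have c1 : ContinuousOn (fun s : ℝ => v t (slicePoint s 0)) (Icc 0 1) := by
      refine h.euler.smooth_velocity.continuousOn.comp (f := fun s : ℝ => (slicePoint s 0, t)) ?_
        fun s hs => ⟨hmem s hs, ht0⟩
      simp only [slicePoint_eq]
      fun_prop
    have c2 := ((EuclideanSpace.proj (𝕜 := ℝ) (1 : Fin 3)).continuous.comp_continuousOn c1) 0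
      ⟨le_rfl, zero_le_one⟩
    have c3 := c2.tendsto.mono_left (nhdsWithin_mono 0 (Ioc_subset_Icc_self (a := (0 : ℝ)) (b := 1)))
    rw [nhdsWithin_Ioc_eq_nhdsGT one_pos] at c3
    simpa [Function.comp_def, hzero] using c3
  -- At this fixed time the swirl is within |d|/2 of d all the way to the axis, far from p₀, so a
  -- bound on W near p₀ alone would not suffice.
  have hbound : ∀ᶠ s : ℝ in 𝓝[>] 0, |v t (slicePoint s 0) 1 - d| ≤ |d| / 2 := by
    filter_upwards [Ioo_mem_nhdsGT one_pos] with s hs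
    have hrad := radius_slicePoint hs.1.le 0
    have hs' := hmem s ⟨hs.1.le, hs.2.le⟩
    have key := h.ansatz.ansatz t ht0 _ hs' (by rw [hrad]; exact hs.1)
    have hsv : selfSimilarVar α T₀ t (slicePoint s 0) ∈ halfPlane := by
      rw [selfSimilarVar, hrad]
      exact div_nonpos_of_nonpos_of_nonneg (by linarith [hs.2]) (Real.rpow_nonneg htpos.le _)
    rw [(hk _ hsv).1, (hV _ hsv).1, (hV _ hsv).2, hαβ, eTheta, hrad] at key
    have k1 := congrArg (fun w : Space3 => w 1) key
    simp [slicePoint, div_self hs.1.ne'] at k1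
    have k2 : v t (slicePoint s 0) 1 - d
        = ε t / (T₀ - t) ^ α * W t (slicePoint s 0) 1 := by
      rw [hd]; simp only [slicePoint]; linarith
    rw [k2, abs_mul, abs_div, abs_of_pos (Real.rpow_pos_of_pos htpos α)]
    have p1 : 1 ≤ (T₀ - t) ^ α :=
      Real.one_le_rpow_of_pos_of_le_one_of_nonpos htpos ht1.le h.alpha.le
    have p2 : |W t (slicePoint s 0) 1| ≤ |M| :=
      (PiLp.norm_apply_le _ 1).trans ((hM t ht0 _ hs' (by rw [hrad]; exact hs.1)).trans
        (le_abs_self M))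
    calc |ε t| / (T₀ - t) ^ α * |W t (slicePoint s 0) 1| ≤ |ε t| * |M| :=
          mul_le_mul (div_le_self (abs_nonneg _) p1) p2 (abs_nonneg _) (abs_nonneg _)
      _ ≤ |d| / 2 := hεt.le
  have hfin := le_of_tendsto (hcont.sub_const d).abs hbound
  rw [zero_sub, abs_neg] at hfin
  have := abs_pos.2 hd0
  linarith

end BlowupData

end AxiEuler
theorem mainTheorem6 (α β : ℝ) (hα : α < 0) (hβ : 0 < β)
    (hαβ : -2 * (β / α) + 1 / α - 1 < 0) (γ : ℝ≥0) (hγ : 0 < γ) (hγ1 : γ < 1) :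
    ¬ ∃ (a b T₀ : ℝ) (v : ℝ → Space3 → Space3) (p : ℝ → Space3 → ℝ)
        (Θ Vr V3 : ℝ × ℝ → ℝ) (ε : ℝ → ℝ) (W : ℝ → Space3 → Space3),
      a < 0 ∧ 0 < b ∧ 0 < T₀ ∧
      AxiEuler.IsSmoothAxisymmetricEuler a b T₀ v p ∧
      AxiEuler.IsAsymptoticallySelfSimilar a b T₀ α β v Θ Vr V3 ε W ∧
      (AxiEuler.IsLocalC2Holder γ Θ ∧ AxiEuler.IsLocalC2Holder γ Vr ∧
        AxiEuler.IsLocalC2Holder γ V3) ∧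
      ((AxiEuler.IsNontrivial Vr ∨ AxiEuler.IsNontrivial V3) ∨
        (AxiEuler.IsNontrivial Θ ∧ AxiEuler.IsGloballyBounded a b T₀ W)) ∧
      (AxiEuler.IsSublinear Vr ∧ AxiEuler.IsSublinear V3) ∧
      (AxiEuler.HasBoundedGradient Vr ∧ AxiEuler.HasBoundedGradient V3) ∧
      (∀ y ∈ AxiEuler.halfPlane, V3 (y.1, -y.2) = -V3 y) := by
  rintro ⟨a, b, T₀, v, p, Θ, Vr, V3, ε, W, ha, hb, hT, hE, hA, ⟨hΘ, hVr, hV3⟩, hnt, ⟨s₁, s₂⟩,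
    ⟨g₁, g₂⟩, hodd⟩
  have hsum : 0 < 1 - α - 2 * β := by
    -- Multiplying the assumed inequality by α < 0 turns it into 1 - α - 2β > 0.
    have h := mul_pos_of_neg_of_neg hα hαβ
    have e : α * (-2 * (β / α) + 1 / α - 1) = 1 - α - 2 * β := by
      field_simp [hα.ne]
      ring
    rwa [e] at h
  have h : AxiEuler.BlowupData a b T₀ α β v p Θ Vr V3 ε W :=
    ⟨hα, hβ, hsum, ha, hb, hT, hE, hA, hΘ.1, hVr.1, hV3.1⟩
  have hV := h.velocity_eq_zero s₁ s₂ g₁ g₂ hodd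
  rcases hnt with (⟨y, hy, hne⟩ | ⟨y, hy, hne⟩) | ⟨⟨y, hy, hne⟩, hW⟩
  · exact hne (hV y hy).1
  · exact hne (hV y hy).2
  · exact hne (h.swirl_eq_zero hV hW y hy)
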